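/- **Theorem 6.3.** Let $\Delta^d=\{x\in\mathbb R^{d+1}: x_j\ge 0,\ \sum_j x_j=1\}$, and let $\Pi^*_{s,t}=(\Delta^1)^s\times(\Delta^2)^t$, whose points are written in the coordinates $x^i_j$ (the $j$-th coordinate in the $i$-th factor). A face of $\Pi^*_{s,t}$ is a nonempty intersection of it with hyperplanes $x^i_j=0$; it is a $\Pi_{s',t'}$ face if it is a product of $s'$ segments and $t'$ triangles (and single vertices in the remaining factors). If $\tau$ is a set of $\dim E+1$ vertices of a face $E$ (with $E=\Pi^*_{s,t}$ allowed), the class of $\tau$ is $|\det[\mathbf 1\,|\,M_v]|$, where $v$ is a vertex of $E$ and the rows of $M_v$ are the points of $\tau$, written in those coordinates that are not identically zero on $E$ and that vanish at $v$; it depends neither on $v$ nor on the order of the rows, and it equals $(\dim E)!$ times the volume of the convex hull of $\tau$ in these coordinates. For integers $s,t,s',t'\ge 0$ and $c,c'\ge 1$, let $F(s,t,c,s',t',c')$ be the maximum, over all nondegenerate $(s+2t)$-dimensional simplices $\alpha$ of class $c$ whose vertices are vertices of $\Pi^*_{s,t}$, of the number of $(s'+2t')$-dimensional faces of $\alpha$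 that have class $c'$ and are contained in a $\Pi_{s',t'}$ face of $\Pi^*_{s,t}$ (and $0$ if there is no such $\alpha$). In particular every vertex of $\alpha$ is counted when $(s',t',c')=(0,0,1)$. Put $F(s,t,c,s',t',c')=0$ if one of $s,t,s',t'$ is negative, one of $c,c'$ is less than $1$, or one of $c,c'$ is not an integer. Then for all integers $s,t,c,s',t',c'$ $$ F(s,t,c,s',t',c')\ \le\ \max_{e}\ \sum_{w=0}^{w'}\ \sum_{k=1}^{c'}\ \sum_{j=0}^{t'}\ \sum_{i=w}^{i'} F(s',t',c',i,j,k)\cdot F\Bigl(s'',t'',\tfrac{c}{c'},\,s'-i+2w,\,t'-j-w,\,\tfrac{c'}{k}\Bigr), $$ where $s''=s'-s+2e$, $t''=s+t-s'-t'-e$, $w'=\min(s'-s+e,\,t')$, $i'=\min(s'+t'-j,\,s'+w)$, and $e$ ranges over the integers with $\max(0,s-s')\le e\le\min(s+t-s'-t',\,s)$. A maximum over the empty set is $0$, a sum whose upper limit is less than its lower limit is $0$, and for $c'\le 0$ the (then empty) sum over $k$ makes the right-hand side $0$. -/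

import Mathlib

namespace Simplotope

/-- The ambient space of the standard coordinate representation of `Δ^{c i}`, `i : ι`:
a point has the coordinates `x i j` with `i : ι` (the factor) and `j : Fin (c i + 1)`. -/
abbrev Space {ι : Type} (c : ι → ℕ) : Type := (i : ι) → Fin (c i + 1) → ℝ

/-- The simplotope `∏ i, Δ^{c i}` in standard coordinates. -/
def simplotope {ι : Type} (c : ι → ℕ) : Set (Space c) :=
  {x | ∀ i, x i ∈ stdSimplex ℝ (Fin (c i + 1))}

/-- A vertex of the simplotope: a choice of one vertex in each factor. -/
abbrev Vertex {ι : Type} (c : ι → ℕ) : Type := (i : ι) → Fin (c i + 1)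

/-- The standard coordinates of a vertex: in every factor a single coordinate is `1`
and all the others are `0`. -/
def vertexPoint {ι : Type} {c : ι → ℕ} (v : Vertex c) : Space c :=
  fun i => Pi.single (v i) 1

/-- A (nonempty) face of the simplotope, given in each factor by the nonempty set of those
coordinates that are not required to vanish. -/
structure Face {ι : Type} (c : ι → ℕ) where
  support : (i : ι) → Finset (Fin (c i + 1))
  nonempty : ∀ i, (support i).Nonempty

/-- The points of a face: the simplotope intersected with the hyperplanes `x i j = 0`
for `j ∉ support i`. -/
def Face.carrier {ι : Type} {c : ι → ℕ} (E : Face c) : Set (Space c) :=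
  {x | x ∈ simplotope c ∧ ∀ i, ∀ j, j ∉ E.support i → x i j = 0}

/-- The simplotope as a face of itself. -/
def Face.whole {ι : Type} (c : ι → ℕ) : Face c where
  support := fun _ => Finset.univ
  nonempty := fun _ => Finset.univ_nonempty

/-- The face `E` is a `Π_{s',t'}` simplotope: it is the product of `s'` segments and `t'`
triangles (all its other factors are single vertices). -/
def Face.IsPi {ι : Type} [Fintype ι] {c : ι → ℕ} (E : Face c) (s' t' : ℕ) : Prop :=
  (∀ i, (E.support i).card ≤ 3) ∧
  (Finset.univ.filter fun i => (E.support i).card = 2).card = s' ∧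
  (Finset.univ.filter fun i => (E.support i).card = 3).card = t'

/-- The coordinates of the face `E` in its reduced coordinate representation with respect to the
vertex `v`: those coordinates of `E` that are zero at `v`. -/
abbrev ReducedCoord {ι : Type} {c : ι → ℕ} (E : Face c) (v : Vertex c) : Type :=
  {p : (i : ι) × Fin (c i + 1) // p.2 ∈ E.support p.1 ∧ p.2 ≠ v p.1}

/-- The square matrix `[1 | M_v]`. Its rows are the vertices `r a`; the column `none` is the column
of ones, and the column `some p` holds the reduced coordinate `p` of the vertices. -/
def augmentedMatrix {ι : Type} {c : ι → ℕ} (E : Face c) (v : Vertex c)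
    (r : Option (ReducedCoord E v) → Vertex c) :
    Matrix (Option (ReducedCoord E v)) (Option (ReducedCoord E v)) ℝ :=
  Matrix.of fun a b => b.elim 1 fun p => vertexPoint (r a) p.1.1 p.1.2

/-- `HasClass E τ k`: the set `τ` consists of `dim E + 1` vertices and its class, computed in
the face `E`, is `k`; that is, `|det [1 | M_v]| = k` for the reduced matrix `M_v` of `τ` with
respect to a vertex `v` of `E`. (For `τ` in `E`, neither the choice of `v` nor the order of the
rows matters.) -/
def HasClass {ι : Type} [Fintype ι] [DecidableEq ι] {c : ι → ℕ} (E : Face c) (τ : Finset (Vertex c)) (k : ℝ) :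
    Prop :=
  ∃ v : Vertex c, (∀ i, v i ∈ E.support i) ∧
    ∃ r : Option (ReducedCoord E v) → Vertex c,
      Function.Injective r ∧ Set.range r = (τ : Set (Vertex c)) ∧
      |(augmentedMatrix E v r).det| = k

/-- `α` is the vertex set of a full-dimensional (nondegenerate) simplex whose vertices are vertices
of the simplotope. -/
def IsSimplex {ι : Type} [Fintype ι] {c : ι → ℕ} (α : Finset (Vertex c)) : Prop :=
  α.card = (∑ i, c i) + 1 ∧ AffineIndependent ℝ (fun v : α => vertexPoint (v : Vertex c))

/-- `τ` is (the vertex set of) an exterior face of the simplex `α` of dimension `s' + 2 t'` and of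
class `k` that lies in a `Π_{s',t'}` face of the simplotope. -/
def IsExteriorFace {ι : Type} [Fintype ι] [DecidableEq ι] {c : ι → ℕ} (α : Finset (Vertex c))
    (s' t' : ℕ) (k : ℝ) (τ : Finset (Vertex c)) : Prop :=
  τ ⊆ α ∧ τ.card = s' + 2 * t' + 1 ∧
    ∃ E : Face c, E.IsPi s' t' ∧ (∀ v ∈ τ, vertexPoint v ∈ E.carrier) ∧ HasClass E τ k

/-- The dimensions of the factors of `Π*_{s,t}`, the product of `s` segments and `t` triangles. -/
def starDims (s t : ℕ) : Fin s ⊕ Fin t → ℕ :=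
  Sum.elim (fun _ => 1) (fun _ => 2)

open Classical in
/-- The number of exterior faces of `α` of class `k` in `Π_{s',t'}` faces. -/
noncomputable def exteriorCount {ι : Type} [Fintype ι] [DecidableEq ι] {c : ι → ℕ}
    (α : Finset (Vertex c)) (s' t' : ℕ) (k : ℝ) : ℕ :=
  (α.powerset.filter fun τ => IsExteriorFace α s' t' k τ).card

open Classical in
/-- `F(s,t,c,s',t',c')`: the maximum, over all simplices `α` of class `c` spanned by vertices of
`Π*_{s,t}`, of the number of exterior `(s'+2t')`-dimensional faces of `α` of class `c'` that lie in
`Π_{s',t'}` faces of `Π*_{s,t}`. It is zero if there is no such `α`, and it is zero by convention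
if one of `s, t, s', t'` is negative or one of `c, c'` is less than `1`. -/
noncomputable def F (s t : ℤ) (c : ℝ) (s' t' : ℤ) (c' : ℝ) : ℕ :=
  if 0 ≤ s ∧ 0 ≤ t ∧ 0 ≤ s' ∧ 0 ≤ t' ∧ 1 ≤ c ∧ 1 ≤ c' then
    (Finset.univ.filter fun α : Finset (Vertex (starDims s.toNat t.toNat)) =>
        IsSimplex α ∧ HasClass (Face.whole _) α c).sup
      fun α => exteriorCount α s'.toNat t'.toNat c'
  else 0

end Simplotope

namespace Simplotope

/-! ### Indices of lattices -/

/-! The class of a vertex set `τ` in a face `E` is a lattice index: `abs_det_augmentedMatrix`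
identifies `|det [1 | M_v]|` with the index `Face.cls` of the lattice generated by the homogenized
points of `τ` in the lattice of all integral points of the span of `E`. In this form the class has
no reference vertex, and it factors along homomorphisms by `relIndex_eq_map_mul_inf_ker`.

If `α` has no exterior face of the required kind, there is nothing to prove. Otherwise fix one, `τ`,
in a face `E`, and contract `E` to a point factor by factor. The result is a product of `s''`
segments and `t''` triangles, where `e` is the number of segment factors in which `E` is a single
vertex. The kernel of the contraction meets the lattice of a face `G` in the height-zero part of the
lattice of `G ∩ E` (`lat_inf_ker`, `lat_inf_lat`). Hence `α` becomes a simplex of class `c/c'`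
(`contract_simplex`), and an exterior face `σ` in `G` splits into `σ ∩ τ`, of some class `k` in `G ∩
E`, and its image, of class `c'/k` (`cls_of_inter`). If `G` and `E` are disjoint, the image keeps
the full class (`cls_of_disjoint`), `k = 1`, and a fixed vertex of `τ` stands in for the empty
intersection.

The contraction is injective on the vertices of `α` outside `τ` and sends none of them to the
contracted point, so `σ` is recovered from the pair (`eq_of_trace_of_image`). Sort the faces `σ` by
`k`, by the numbers `i`, `j` of segments and triangles in `G ∩ E`, and by the number `w` of
triangles of `G` that meet `E` in an edge. Each fibre injects into a product of two sets of exterior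
faces, whose sizes are bounded by the two values of `F`. -/

/-- Interpose `H ⊔ (K ⊓ f.ker)` between `H` and `K`: the upper step is seen in the images under `f`,
the lower one by the second isomorphism theorem in the kernel. -/
theorem relIndex_eq_map_mul_inf_ker {A B : Type*} [AddCommGroup A] [AddCommGroup B] (f : A →+ B)
    {H K : AddSubgroup A} (h : H ≤ K) :
    H.relIndex K = (H.map f).relIndex (K.map f) * (H ⊓ f.ker).relIndex (K ⊓ f.ker) := by
  have h1 : (H ⊔ (K ⊓ f.ker)).relIndex K = (H.map f).relIndex (K.map f) := by
    rw [← AddSubgroup.relIndex_comap, AddSubgroup.comap_map_eq]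
    rw [← AddSubgroup.inf_relIndex_right (H ⊔ f.ker) K, sup_inf_assoc_of_le _ h, inf_comm K]
  have h2 : H.relIndex (H ⊔ (K ⊓ f.ker)) = (H ⊓ f.ker).relIndex (K ⊓ f.ker) := by
    rw [sup_comm, AddSubgroup.relIndex_sup_right, ← AddSubgroup.inf_relIndex_right H]
    congr 1
    rw [← inf_assoc, inf_eq_left.mpr h]
  rw [← h1, ← h2, mul_comm,
    AddSubgroup.relIndex_mul_relIndex _ _ _ le_sup_left (sup_le h inf_le_left)]

theorem relIndex_map_map_of_inf_ker {A B : Type*} [AddCommGroup A] [AddCommGroup B] (f : A →+ B)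
    {H K : AddSubgroup A} (h : H ≤ K) (hK : K ⊓ f.ker = ⊥) :
    (H.map f).relIndex (K.map f) = H.relIndex K := by
  rw [relIndex_eq_map_mul_inf_ker f h, hK, AddSubgroup.relIndex_bot_right, mul_one]

theorem index_span_rows {n : Type*} [Fintype n] [DecidableEq n] (A : Matrix n n ℤ) :
    (Submodule.span ℤ (Set.range A)).toAddSubgroup.index = A.det.natAbs := by
  by_cases hA : A.det = 0
  · rw [hA, Int.natAbs_zero]
    -- A nonzero (finite) index `N` would put every `N • eᵢ` in the row span, giving `B * A = N • 1`
    -- and contradicting `det A = 0`.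
    by_contra hne
    have hm : ∀ i, ((Submodule.span ℤ (Set.range A)).toAddSubgroup.index : ℤ) •
        (Pi.single i 1 : n → ℤ) ∈ Submodule.span ℤ (Set.range A) := by
      intro i
      have := AddSubgroup.nsmul_index_mem (Submodule.span ℤ (Set.range A)).toAddSubgroup
        (Pi.single i 1 : n → ℤ)
      rw [natCast_zsmul]
      exact this
    set N := (Submodule.span ℤ (Set.range A)).toAddSubgroup.index
    choose B hB using fun i => (Submodule.mem_span_range_iff_exists_fun ℤ).1 (hm i)
    have hBA : Matrix.of B * A = (N : ℤ) • (1 : Matrix n n ℤ) := by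
      ext i j
      have := congrFun (hB i) j
      simpa [Matrix.mul_apply, Matrix.one_apply, Pi.single_apply, eq_comm] using this
    have := congrArg Matrix.det hBA
    rw [Matrix.det_mul, hA, mul_zero, Matrix.det_smul, Matrix.det_one, mul_one] at this
    exact pow_ne_zero _ (by exact_mod_cast hne) this.symm
  · have hli : LinearIndependent ℤ (fun i => A i) := Matrix.linearIndependent_rows_of_det_ne_zero hA
    rw [AddSubgroup.index_eq_natAbs_det (Pi.basisFun ℤ n) _ (Module.Basis.span hli)]
    congr 1
    rw [Pi.basisFun_det_apply]
    congr 1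
    ext i j
    exact congrFun (congrArg Subtype.val (Module.Basis.span_apply hli i)) j

/-- Multiplication by the finite index embeds `K` into `H`. -/
theorem finrank_le_of_relIndex_ne_zero {A : Type*} [AddCommGroup A] {H K : Submodule ℤ A}
    [Module.Finite ℤ H] [Module.Free ℤ H] [Module.IsTorsionFree ℤ A]
    (h : H.toAddSubgroup.relIndex K.toAddSubgroup ≠ 0) :
    Module.finrank ℤ K ≤ Module.finrank ℤ H := by
  set N := H.toAddSubgroup.relIndex K.toAddSubgroup with hN
  have hmem : ∀ x : K, (N : ℤ) • (x : A) ∈ H := by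
    intro x
    have := AddSubgroup.nsmul_index_mem (H.toAddSubgroup.addSubgroupOf K.toAddSubgroup) x
    rw [natCast_zsmul]
    exact this
  let f : K →ₗ[ℤ] H := ((N : ℤ) • K.subtype).codRestrict H hmem
  refine LinearMap.finrank_le_finrank_of_injective (f := f) fun x y hxy => ?_
  have : (N : ℤ) • (x : A) = (N : ℤ) • (y : A) := congrArg Subtype.val hxy
  exact Subtype.ext (smul_right_injective A (by exact_mod_cast h) this)

/-! ### The lattice of a face -/

section Lattice

variable {ι : Type} {c : ι → ℕ}

/-- Integral vectors in the homogenized standard coordinates of a simplotope. -/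
abbrev Amb (c : ι → ℕ) : Type := ℤ × ((i : ι) → Fin (c i + 1) → ℤ)

/-- The homogenized standard coordinates of a vertex. -/
def vec (v : Vertex c) : Amb c := (1, fun i => Pi.single (v i) 1)

/-- The vertices of a face. -/
def Face.verts (E : Face c) : Set (Vertex c) := {v | ∀ i, v i ∈ E.support i}

/-- The lattice generated by a set of vertices. -/
def gen (S : Set (Vertex c)) : Submodule ℤ (Amb c) := Submodule.span ℤ (vec '' S)

/-- The lattice of all integral points of the linear span of a face. -/
def Face.lat (E : Face c) : Submodule ℤ (Amb c) where
  carrier := {x | (∀ i, ∑ j, x.2 i j = x.1) ∧ ∀ i, ∀ j ∉ E.support i, x.2 i j = 0}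
  zero_mem' := by simp
  add_mem' := by
    rintro x y ⟨hx, hx'⟩ ⟨hy, hy'⟩
    refine ⟨fun i => ?_, fun i j hj => ?_⟩
    · simp [Finset.sum_add_distrib, hx, hy]
    · simp [hx' i j hj, hy' i j hj]
  smul_mem' := by
    rintro a x ⟨hx, hx'⟩
    refine ⟨fun i => ?_, fun i j hj => ?_⟩
    · simp [← Finset.mul_sum, hx]
    · simp [hx' i j hj]

theorem Face.mem_lat {E : Face c} {x : Amb c} :
    x ∈ E.lat ↔ (∀ i, ∑ j, x.2 i j = x.1) ∧ ∀ i, ∀ j ∉ E.support i, x.2 i j = 0 := Iff.rfl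

theorem vec_mem_lat_iff {E : Face c} {v : Vertex c} : vec v ∈ E.lat ↔ v ∈ E.verts := by
  constructor
  · intro h i
    by_contra hi
    simpa [vec] using h.2 i _ hi
  · intro h
    refine ⟨fun i => by simp [vec], fun i j hj => ?_⟩
    have : j ≠ v i := fun e => hj (e ▸ h i)
    simp [vec, this]

theorem gen_mono {S T : Set (Vertex c)} (h : S ⊆ T) : gen S ≤ gen T :=
  Submodule.span_mono (Set.image_mono h)

theorem vec_mem_gen {S : Set (Vertex c)} {v : Vertex c} (h : v ∈ S) : vec v ∈ gen S :=
  Submodule.subset_span ⟨v, h, rfl⟩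

theorem gen_le_lat {E : Face c} {S : Set (Vertex c)} (h : S ⊆ E.verts) : gen S ≤ E.lat := by
  rw [gen, Submodule.span_le]
  rintro _ ⟨v, hv, rfl⟩
  exact vec_mem_lat_iff.2 (h hv)

theorem Face.exists_mem_verts (E : Face c) : E.verts.Nonempty :=
  ⟨fun i => (E.nonempty i).choose, fun i => (E.nonempty i).choose_spec⟩

/-- The reduced coordinates with respect to a vertex, preceded by the homogenizing coordinate. -/
def reduced (E : Face c) (v : Vertex c) : Amb c →ₗ[ℤ] (Option (ReducedCoord E v) → ℤ) where
  toFun x b := b.elim x.1 fun p => x.2 p.1.1 p.1.2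
  map_add' x y := by ext b; cases b <;> rfl
  map_smul' a x := by ext b; cases b <;> rfl

/-- The only coordinates dropped inside `E` are those at `v`, and the condition that each factor
sums to the height recovers them. -/
theorem reduced_injOn {E : Face c} {v : Vertex c} {x : Amb c} (hx : x ∈ E.lat)
    (h : reduced E v x = 0) : x = 0 := by
  have h1 : x.1 = 0 := congrFun h none
  have h2 : ∀ i j, j ≠ v i → x.2 i j = 0 := by
    intro i j hj
    by_cases hE : j ∈ E.support i
    · exact congrFun h (some ⟨⟨i, j⟩, hE, hj⟩)
    · exact hx.2 i j hE
  refine Prod.ext h1 (funext fun i => funext fun j => ?_)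
  by_cases hj : j = v i
  · have := hx.1 i
    rw [Finset.sum_eq_single (v i) (fun j _ hj => h2 i j hj) (by simp), h1] at this
    rw [hj]; exact this
  · exact h2 i j hj

/-- The index of the lattice generated by a set of vertices of a face in the lattice of that face
(and `0` if it is infinite). -/
noncomputable def Face.cls (E : Face c) (τ : Finset (Vertex c)) : ℕ :=
  (gen (τ : Set (Vertex c))).toAddSubgroup.relIndex E.lat.toAddSubgroup

theorem augmentedMatrix_eq_map (E : Face c) (v : Vertex c)
    (r : Option (ReducedCoord E v) → Vertex c) :
    augmentedMatrix E v r =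
      (Matrix.of fun a => reduced E v (vec (r a))).map (Int.castRingHom ℝ) := by
  ext a b
  rcases b with _ | p
  · simp [augmentedMatrix, reduced, vec]
  · simp only [augmentedMatrix, reduced, vec, vertexPoint, Matrix.of_apply, Matrix.map_apply,
      Option.elim, LinearMap.coe_mk, AddHom.coe_mk, Pi.single_apply]
    split_ifs <;> simp

/-- Vertices which are linearly independent and almost generate the lattice of a face are all the
vertices of the simplex which lie in that face. -/
theorem gen_inf_lat {E : Face c} {α σ τ : Finset (Vertex c)}
    (hα : LinearIndepOn ℤ vec (α : Set (Vertex c))) (hσ : σ ⊆ α) (hτ : τ ⊆ α)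
    (hτE : (τ : Set (Vertex c)) ⊆ E.verts) (h : E.cls τ ≠ 0) :
    gen (σ : Set (Vertex c)) ⊓ E.lat = gen ((σ : Set (Vertex c)) ∩ τ) := by
  refine le_antisymm ?_ (le_inf (gen_mono Set.inter_subset_left)
    (gen_le_lat (Set.inter_subset_right.trans hτE)))
  rintro x ⟨hx, hxE⟩
  have hN : (E.cls τ : ℤ) • x ∈ gen (τ : Set (Vertex c)) := by
    have := AddSubgroup.nsmul_index_mem
      ((gen (τ : Set (Vertex c))).toAddSubgroup.addSubgroupOf E.lat.toAddSubgroup) ⟨x, hxE⟩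
    rw [natCast_zsmul]
    exact this
  rw [gen, Finsupp.mem_span_image_iff_linearCombination] at hN
  rw [gen, SetLike.mem_coe, Finsupp.mem_span_image_iff_linearCombination] at hx
  obtain ⟨a, ha, rfl⟩ := hx
  obtain ⟨b, hb, hab⟩ := hN
  -- Both `N • x` and its expression in `τ` are combinations of the independent family `α`, so the
  -- coefficients agree and `x` itself is supported on `τ`.
  have hsub : (E.cls τ : ℤ) • a - b = 0 := by
    refine linearIndepOn_iff.1 hα _ (sub_mem (Submodule.smul_mem _ _ ?_) ?_) ?_
    · exact Finsupp.supported_mono (by exact_mod_cast hσ) ha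
    · exact Finsupp.supported_mono (by exact_mod_cast hτ) hb
    · rw [map_sub, map_smul, hab, sub_self]
  rw [gen, Finsupp.mem_span_image_iff_linearCombination]
  refine ⟨a, ?_, rfl⟩
  rw [Finsupp.mem_supported] at ha hb ⊢
  intro v hv
  refine ⟨ha hv, hb ?_⟩
  rw [← sub_eq_zero.1 hsub]
  simpa [h] using hv

variable [Fintype ι]

/-- The dimension of a face plus one. -/
def Face.rk (E : Face c) : ℕ := (∑ i, ((E.support i).card - 1)) + 1

theorem card_option_reducedCoord {E : Face c} {v : Vertex c} (hv : v ∈ E.verts) :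
    Fintype.card (Option (ReducedCoord E v)) = E.rk := by
  rw [Fintype.card_option, Face.rk, Fintype.card_subtype]
  congr 1
  have : (Finset.univ.filter fun p : (i : ι) × Fin (c i + 1) => p.2 ∈ E.support p.1 ∧ p.2 ≠ v p.1)
      = Finset.univ.sigma fun i => (E.support i).erase (v i) := by
    ext p
    simp [and_comm]
  rw [this, Finset.card_sigma]
  exact Finset.sum_congr rfl fun i _ => Finset.card_erase_of_mem (hv i)

variable [DecidableEq ι]

/-- Changing `v` in a single factor and subtracting `v` yields a unit vector in reduced coordinates,
so the vertices of a face already generate everything. -/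
theorem map_reduced_gen_verts {E : Face c} {v : Vertex c} (hv : v ∈ E.verts) :
    (gen E.verts).map (reduced E v) = ⊤ := by
  have h0 : (Pi.single none 1 : Option (ReducedCoord E v) → ℤ) = reduced E v (vec v) := by
    ext b
    rcases b with _ | p
    · simp [reduced, vec]
    · simp [reduced, vec, p.2.2]
  have hs : ∀ p, (Pi.single (some p) 1 : Option (ReducedCoord E v) → ℤ) =
      reduced E v (vec (Function.update v p.1.1 p.1.2)) - reduced E v (vec v) := by
    rintro ⟨⟨i, j⟩, hj⟩
    ext b
    rcases b with _ | ⟨⟨i', j'⟩, hj'⟩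
    · simp [reduced, vec]
    · by_cases hi : i' = i
      · subst hi
        have := hj'.2
        simp only at this
        simp [reduced, vec, Pi.single_apply, this]
      · have : (⟨⟨i', j'⟩, hj'⟩ : ReducedCoord E v) ≠ ⟨⟨i, j⟩, hj⟩ := by
          intro e; exact hi (congrArg (fun p => p.1.1) e)
        simp [reduced, vec, hi, this]
  rw [eq_top_iff, ← (Pi.basisFun ℤ (Option (ReducedCoord E v))).span_eq, Submodule.span_le]
  rintro _ ⟨b, rfl⟩
  rw [Pi.basisFun_apply]
  have hv' := Submodule.mem_map_of_mem (f := reduced E v) (vec_mem_gen hv)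
  rcases b with _ | p
  · rw [h0]; exact hv'
  · rw [hs]
    refine sub_mem (Submodule.mem_map_of_mem (vec_mem_gen fun i => ?_)) hv'
    by_cases hi : i = p.1.1
    · subst hi; simpa using p.2.1
    · simpa [hi] using hv i

theorem Face.lat_eq_gen (E : Face c) : E.lat = gen E.verts := by
  obtain ⟨v, hv⟩ := E.exists_mem_verts
  refine le_antisymm (fun x hx => ?_) (gen_le_lat le_rfl)
  have : reduced E v x ∈ (gen E.verts).map (reduced E v) := by
    rw [map_reduced_gen_verts hv]; trivial
  obtain ⟨y, hy, hxy⟩ := this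
  have h := reduced_injOn (E := E) (v := v) (sub_mem hx (gen_le_lat le_rfl hy))
    (by rw [map_sub, hxy, sub_self])
  rw [sub_eq_zero.1 h]; exact hy

theorem map_reduced_lat {E : Face c} {v : Vertex c} (hv : v ∈ E.verts) :
    E.lat.map (reduced E v) = ⊤ := by
  rw [E.lat_eq_gen, map_reduced_gen_verts hv]

theorem finrank_lat (E : Face c) : Module.finrank ℤ E.lat = E.rk := by
  obtain ⟨v, hv⟩ := E.exists_mem_verts
  let f : E.lat →ₗ[ℤ] (Option (ReducedCoord E v) → ℤ) := (reduced E v).domRestrict E.lat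
  have hf : Function.Bijective f := by
    constructor
    · rw [← LinearMap.ker_eq_bot, LinearMap.ker_eq_bot']
      exact fun x hx => Subtype.ext (reduced_injOn x.2 hx)
    · intro y
      have : y ∈ E.lat.map (reduced E v) := by rw [map_reduced_lat hv]; trivial
      obtain ⟨x, hx, hxy⟩ := this
      exact ⟨⟨x, hx⟩, hxy⟩
  rw [(LinearEquiv.ofBijective f hf).finrank_eq, Module.finrank_fintype_fun_eq_card,
    card_option_reducedCoord hv]

/-- Reduced coordinates are an isomorphism from the lattice of `E` onto the standard lattice, so the
index of the row span, which is `|det|`, is the intrinsic index and is the same for every `v`. -/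
theorem abs_det_augmentedMatrix {E : Face c} {v : Vertex c} (hv : v ∈ E.verts)
    {τ : Finset (Vertex c)} (hτ : (τ : Set (Vertex c)) ⊆ E.verts)
    {r : Option (ReducedCoord E v) → Vertex c} (hr : Set.range r = (τ : Set (Vertex c))) :
    |(augmentedMatrix E v r).det| = E.cls τ := by
  have h1 : E.lat.toAddSubgroup ⊓ (reduced E v).toAddMonoidHom.ker = ⊥ := by
    rw [eq_bot_iff]
    rintro x ⟨hx, hx'⟩
    exact reduced_injOn hx hx'
  rw [augmentedMatrix_eq_map, ← RingHom.mapMatrix_apply, ← RingHom.map_det, eq_intCast,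
    ← Int.cast_abs, Int.abs_eq_natAbs, Int.cast_natCast, ← index_span_rows, Face.cls,
    ← relIndex_map_map_of_inf_ker (reduced E v).toAddMonoidHom (gen_le_lat hτ) h1]
  have h2 : E.lat.toAddSubgroup.map (reduced E v).toAddMonoidHom = ⊤ := by
    have := congrArg Submodule.toAddSubgroup (map_reduced_lat hv)
    rwa [Submodule.map_toAddSubgroup] at this
  rw [h2, AddSubgroup.relIndex_top_right]
  have h3 : (gen (τ : Set (Vertex c))).map (reduced E v) =
      Submodule.span ℤ (Set.range fun a => reduced E v (vec (r a))) := by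
    rw [gen, Submodule.map_span, ← hr, ← Set.range_comp, ← Set.range_comp]
    rfl
  have := congrArg Submodule.toAddSubgroup h3
  rw [Submodule.map_toAddSubgroup] at this
  congr 2
  exact this.symm

theorem hasClass_iff {E : Face c} {τ : Finset (Vertex c)} (hτ : (τ : Set (Vertex c)) ⊆ E.verts)
    {k : ℝ} : HasClass E τ k ↔ τ.card = E.rk ∧ (E.cls τ : ℝ) = k := by
  constructor
  · rintro ⟨v, hv, r, hr, hrτ, hk⟩
    refine ⟨?_, by rw [← hk, abs_det_augmentedMatrix hv hτ hrτ]⟩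
    rw [← card_option_reducedCoord hv, ← Set.ncard_coe_finset, ← hrτ, Set.ncard_eq_toFinset_card',
      Set.toFinset_range, Finset.card_image_of_injective _ hr, Finset.card_univ]
  · rintro ⟨hcard, hk⟩
    obtain ⟨v, hv⟩ := E.exists_mem_verts
    have : Fintype.card (Option (ReducedCoord E v)) = Fintype.card τ := by
      rw [card_option_reducedCoord hv, Fintype.card_coe, hcard]
    let e := Fintype.equivOfCardEq this
    have hr : Set.range (fun a => (e a : Vertex c)) = (τ : Set (Vertex c)) := by
      ext x
      constructor
      · rintro ⟨a, rfl⟩; exact (e a).2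
      · intro hx; exact ⟨e.symm ⟨x, hx⟩, by simp⟩
    exact ⟨v, hv, fun a => e a, Subtype.val_injective.comp e.injective, hr, by
      rw [abs_det_augmentedMatrix hv hτ hr, hk]⟩

theorem linearIndepOn_vec_of_hasClass {E : Face c} {τ : Finset (Vertex c)} {k : ℝ}
    (h : HasClass E τ k) (hk : k ≠ 0) : LinearIndepOn ℤ vec (τ : Set (Vertex c)) := by
  obtain ⟨v, hv, r, hr, hrτ, rfl⟩ := h
  rw [abs_ne_zero, augmentedMatrix_eq_map, ← RingHom.mapMatrix_apply, ← RingHom.map_det,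
    eq_intCast, Int.cast_ne_zero] at hk
  have h1 : LinearIndependent ℤ (fun a => vec (r a)) :=
    LinearIndependent.of_comp (reduced E v) (Matrix.linearIndependent_rows_of_det_ne_zero hk)
  rw [← hrτ]
  exact (linearIndepOn_range_iff hr vec).2 h1

/-- An affine relation among the vertices is a linear relation among the rows of `[1 | M_v]`. Thus
nonzero class alone makes a contracted or restricted vertex set admissible in `F`. -/
theorem isSimplex_of_hasClass {α : Finset (Vertex c)} {k : ℝ}
    (h : HasClass (Face.whole c) α k) (hk : k ≠ 0) : IsSimplex α := by
  have hcard := ((hasClass_iff (E := Face.whole c) (τ := α)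
    (fun v _ i => Finset.mem_univ _)).1 h).1
  refine ⟨by rw [hcard]; simp [Face.rk, Face.whole], ?_⟩
  obtain ⟨v, hv, r, hr, hrα, rfl⟩ := h
  rw [abs_ne_zero] at hk
  have hli : LinearIndependent ℝ (augmentedMatrix _ v r).row :=
    Matrix.linearIndependent_rows_of_det_ne_zero hk
  have key : AffineIndependent ℝ (fun a => vertexPoint (r a)) := by
    rw [affineIndependent_iff_of_fintype]
    intro w hw hw' a
    rw [Finset.weightedVSub_eq_linear_combination _ hw] at hw'
    rw [Fintype.linearIndependent_iff] at hli
    refine hli w ?_ a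
    ext b
    rcases b with _ | p
    · simpa [augmentedMatrix, Matrix.row] using hw
    · have := congrFun (congrFun hw' p.1.1) p.1.2
      simpa [augmentedMatrix, Matrix.row] using this
  have := key.range
  have h2 : Set.range (fun a => vertexPoint (r a)) = vertexPoint '' (α : Set (Vertex c)) := by
    rw [← hrα, ← Set.range_comp]; rfl
  rw [h2] at this
  let f : α ↪ (vertexPoint '' (α : Set (Vertex c)) : Set (Space c)) :=
    ⟨fun v => ⟨vertexPoint v.1, v.1, v.2, rfl⟩, by
      intro x y hxy
      have hxy' : vertexPoint x.1 = vertexPoint y.1 := congrArg Subtype.val hxy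
      refine Subtype.ext (funext fun i => ?_)
      have := congrFun (congrFun hxy' i) (x.1 i)
      by_contra hne
      simp [vertexPoint, hne] at this⟩
  exact this.comp_embedding f

theorem card_eq_rk_of_cls_ne_zero {E : Face c} {τ : Finset (Vertex c)}
    (hli : LinearIndepOn ℤ vec (τ : Set (Vertex c))) (hτE : (τ : Set (Vertex c)) ⊆ E.verts)
    (h : E.cls τ ≠ 0) : τ.card = E.rk := by
  have hcard : Module.finrank ℤ (gen (τ : Set (Vertex c))) = τ.card := by
    have : gen (τ : Set (Vertex c)) = Submodule.span ℤ (Set.range fun v : (τ : Set (Vertex c)) => vec v.1) := by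
      rw [gen, Set.image_eq_range]
    rw [this, finrank_span_eq_card hli]
    simp
  rw [← finrank_lat, ← hcard]
  have : Module.Finite ℤ E.lat := Module.Finite.of_fg (IsNoetherian.noetherian _)
  exact le_antisymm (Submodule.finrank_mono (gen_le_lat hτE)) (finrank_le_of_relIndex_ne_zero h)

theorem rk_le_card_of_cls_ne_zero {E : Face c} {τ : Finset (Vertex c)} (h : E.cls τ ≠ 0) :
    E.rk ≤ τ.card := by
  classical
  rw [← finrank_lat]
  refine (finrank_le_of_relIndex_ne_zero h).trans ?_
  have : gen (τ : Set (Vertex c)) = Submodule.span ℤ ((τ.image vec : Finset (Amb c)) : Set (Amb c)) := by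
    rw [gen, Finset.coe_image]
  rw [this]
  exact (finrank_span_finset_le_card _).trans Finset.card_image_le

end Lattice

/-! ### Maps of simplotopes -/

/-- A map between simplotopes which, in each factor of the target, is given by a map
from the vertices of one factor of the source. -/
structure FactorMap {ι κ : Type} (c : ι → ℕ) (d : κ → ℕ) where
  idx : κ → ι
  idx_injective : Function.Injective idx
  toFun : ∀ k, Fin (c (idx k) + 1) → Fin (d k + 1)

section FactorMap

variable {ι κ : Type} {c : ι → ℕ} {d : κ → ℕ}

namespace FactorMap

/-- The action on vertices. -/
def onVertex (q : FactorMap c d) (v : Vertex c) : Vertex d := fun k => q.toFun k (v (q.idx k))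

/-- The image of a face. -/
def onFace (q : FactorMap c d) (E : Face c) : Face d where
  support := fun k => (E.support (q.idx k)).image (q.toFun k)
  nonempty := fun k => (E.nonempty (q.idx k)).image _

/-- The induced linear map. -/
def push (q : FactorMap c d) : Amb c →ₗ[ℤ] Amb d where
  toFun x := (x.1, fun k y => ∑ j, if q.toFun k j = y then x.2 (q.idx k) j else 0)
  map_add' x y := by
    refine Prod.ext rfl (funext fun k => funext fun z => ?_)
    simp only [Prod.snd_add, Pi.add_apply, ← Finset.sum_add_distrib]
    exact Finset.sum_congr rfl fun j _ => by split_ifs <;> simp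
  map_smul' a x := by
    refine Prod.ext rfl (funext fun k => funext fun z => ?_)
    simp [Finset.mul_sum]

theorem push_vec (q : FactorMap c d) (v : Vertex c) : q.push (vec v) = vec (q.onVertex v) := by
  refine Prod.ext rfl (funext fun k => funext fun z => ?_)
  simp only [push, vec, onVertex, LinearMap.coe_mk, AddHom.coe_mk]
  rw [Finset.sum_eq_single (v (q.idx k))]
  · simp [Pi.single_apply, eq_comm]
  · intro j _ hj; simp [hj]
  · simp

theorem map_push_gen (q : FactorMap c d) (S : Set (Vertex c)) :
    (gen S).map q.push = gen (q.onVertex '' S) := by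
  rw [gen, gen, Submodule.map_span, Set.image_image, Set.image_image]
  simp_rw [push_vec]

theorem onVertex_mem {q : FactorMap c d} {E : Face c} {v : Vertex c} (hv : v ∈ E.verts) :
    q.onVertex v ∈ (q.onFace E).verts := fun _ => Finset.mem_image_of_mem _ (hv _)

theorem image_verts (q : FactorMap c d) (E : Face c) :
    q.onVertex '' E.verts = (q.onFace E).verts := by
  ext u
  constructor
  · rintro ⟨v, hv, rfl⟩; exact onVertex_mem hv
  · intro hu
    -- Since `idx` is injective, each source factor serves at most one target factor, so a preimage
    -- can be chosen independently in each factor; unused factors are free.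
    have : ∀ i, ∃ a ∈ E.support i, ∀ k, ∀ h : i = q.idx k, q.toFun k (h ▸ a) = u k := by
      intro i
      by_cases hi : ∃ k, i = q.idx k
      · obtain ⟨k, rfl⟩ := hi
        obtain ⟨a, ha, hau⟩ := Finset.mem_image.1 (hu k)
        refine ⟨a, ha, fun k' h => ?_⟩
        obtain rfl := q.idx_injective h
        exact hau
      · obtain ⟨a, ha⟩ := E.nonempty i
        exact ⟨a, ha, fun k h => absurd ⟨k, h⟩ hi⟩
    choose v hv hvu using this
    exact ⟨v, hv, funext fun k => hvu _ k rfl⟩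

/-- `q` contracts the face `E` to a vertex and is injective otherwise. -/
structure IsCollapse (q : FactorMap c d) (E : Face c) : Prop where
  apply_eq : ∀ k, ∃ y, ∀ j, q.toFun k j = y ↔ j ∈ E.support (q.idx k)
  injOn : ∀ k, Set.InjOn (q.toFun k) {j | j ∉ E.support (q.idx k)}
  surjective : ∀ k, Function.Surjective (q.toFun k)
  support_eq : ∀ i ∉ Set.range q.idx, E.support i = Finset.univ

/-- `q` restricts to an isomorphism from the face `E` onto its image. -/
structure IsIsoOn (q : FactorMap c d) (E : Face c) : Prop where
  injOn : ∀ k, Set.InjOn (q.toFun k) (E.support (q.idx k))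
  card_eq : ∀ i ∉ Set.range q.idx, (E.support i).card = 1

theorem IsCollapse.exists_vertex {q : FactorMap c d} {E : Face c} (h : q.IsCollapse E) :
    ∃ u, ∀ v, q.onVertex v = u ↔ v ∈ E.verts := by
  choose u hu using h.apply_eq
  refine ⟨u, fun v => ⟨fun hv i => ?_, fun hv => funext fun k => (hu k _).2 (hv _)⟩⟩
  by_cases hi : i ∈ Set.range q.idx
  · obtain ⟨k, rfl⟩ := hi
    exact (hu k _).1 (congrFun hv k)
  · rw [h.support_eq i hi]; exact Finset.mem_univ _

/-- Coordinates outside `E` survive unchanged under `push`, so they must vanish in the kernel. The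
coordinate at the contracted vertex is then the sum over the whole factor, that is, the height. -/
theorem IsCollapse.push_eq_zero_iff {q : FactorMap c d} {E : Face c} (h : q.IsCollapse E)
    {x : Amb c} (hx : ∀ i, ∑ j, x.2 i j = x.1) : q.push x = 0 ↔ x ∈ E.lat ∧ x.1 = 0 := by
  have hval : ∀ k j, j ∉ E.support (q.idx k) →
      (q.push x).2 k (q.toFun k j) = x.2 (q.idx k) j := by
    intro k j hj
    simp only [push, LinearMap.coe_mk, AddHom.coe_mk]
    rw [Finset.sum_eq_single j]
    · simp
    · intro j' _ hj'
      refine if_neg fun e => hj' ?_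
      refine h.injOn k ?_ hj e
      obtain ⟨y, hy⟩ := h.apply_eq k
      intro hj''
      exact hj ((hy j).1 (e ▸ (hy j').2 hj''))
    · simp
  constructor
  · intro h0
    refine ⟨⟨hx, fun i j hj => ?_⟩, congrArg Prod.fst h0⟩
    by_cases hi : i ∈ Set.range q.idx
    · obtain ⟨k, rfl⟩ := hi
      rw [← hval k j hj, h0]; rfl
    · rw [h.support_eq i hi] at hj; exact absurd (Finset.mem_univ _) hj
  · rintro ⟨hE, h1⟩
    refine Prod.ext h1 (funext fun k => funext fun z => ?_)
    obtain ⟨j, rfl⟩ := h.surjective k z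
    by_cases hj : j ∈ E.support (q.idx k)
    · simp only [push, LinearMap.coe_mk, AddHom.coe_mk]
      obtain ⟨y, hy⟩ := h.apply_eq k
      rw [(hy j).2 hj]
      refine Eq.trans ?_ ((hx (q.idx k)).trans h1)
      refine Finset.sum_congr rfl fun j' _ => ?_
      split_ifs with hj'
      · rfl
      · exact (hE.2 _ _ fun hj'' => hj' ((hy j').2 hj'')).symm
    · rw [hval k j hj, hE.2 _ _ hj]; rfl

theorem IsIsoOn.push_eq_zero {q : FactorMap c d} {E : Face c} (h : q.IsIsoOn E)
    {x : Amb c} (hx : x ∈ E.lat) (h0 : q.push x = 0) : x = 0 := by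
  have h1 : x.1 = 0 := congrArg Prod.fst h0
  refine Prod.ext h1 (funext fun i => funext fun j => ?_)
  by_cases hj : j ∈ E.support i
  swap
  · exact hx.2 i j hj
  by_cases hi : i ∈ Set.range q.idx
  · obtain ⟨k, rfl⟩ := hi
    have := congrFun (congrFun (congrArg Prod.snd h0) k) (q.toFun k j)
    simp only [push, LinearMap.coe_mk, AddHom.coe_mk] at this
    rw [Finset.sum_eq_single j] at this
    · simpa using this
    · intro j' _ hj'
      split_ifs with e
      · exact hx.2 _ _ fun hj'' => hj' (h.injOn k hj'' hj e)
      · rfl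
    · simp
  · obtain ⟨a, ha⟩ := Finset.card_eq_one.1 (h.card_eq i hi)
    rw [ha, Finset.mem_singleton] at hj
    subst hj
    have := hx.1 i
    rw [Finset.sum_eq_single j (fun j' _ hj' => hx.2 _ _ (by simp [ha, hj'])) (by simp), h1] at this
    exact this

theorem IsIsoOn.mono {q : FactorMap c d} {E G : Face c} (h : q.IsIsoOn E)
    (hG : ∀ i, G.support i ⊆ E.support i) : q.IsIsoOn G :=
  ⟨fun k => (h.injOn k).mono (by exact_mod_cast hG _), fun i hi =>
    le_antisymm ((Finset.card_le_card (hG i)).trans (h.card_eq i hi).le)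
      (G.nonempty i).card_pos⟩

theorem IsIsoOn.onVertex_injOn {q : FactorMap c d} {E : Face c} (h : q.IsIsoOn E) :
    Set.InjOn q.onVertex E.verts := by
  intro v hv w hw hvw
  have h0 : vec v - vec w = 0 := h.push_eq_zero
    (sub_mem (vec_mem_lat_iff.2 hv) (vec_mem_lat_iff.2 hw))
    (by rw [map_sub, push_vec, push_vec, hvw, sub_self])
  funext i
  have := congrFun (congrFun (congrArg Prod.snd (sub_eq_zero.1 h0)) i) (v i)
  by_contra hne
  simp [vec, hne] at this

variable [Fintype ι] [DecidableEq ι] [Fintype κ] [DecidableEq κ]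

theorem map_push_lat (q : FactorMap c d) (E : Face c) : E.lat.map q.push = (q.onFace E).lat := by
  rw [E.lat_eq_gen, map_push_gen, image_verts, Face.lat_eq_gen]

/-- The class of the image splits off; the remaining kernel index is what the collapse lemmas
identify with the class in `G ∩ E`. -/
theorem cls_eq_mul (q : FactorMap c d) {G : Face c} {σ : Finset (Vertex c)}
    (hσ : (σ : Set (Vertex c)) ⊆ G.verts) :
    G.cls σ = (q.onFace G).cls (σ.image q.onVertex) *
      ((gen (σ : Set (Vertex c))).toAddSubgroup ⊓ q.push.toAddMonoidHom.ker).relIndex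
        (G.lat.toAddSubgroup ⊓ q.push.toAddMonoidHom.ker) := by
  rw [Face.cls, relIndex_eq_map_mul_inf_ker q.push.toAddMonoidHom (gen_le_lat hσ), Face.cls]
  congr 2
  · have := congrArg Submodule.toAddSubgroup (q.map_push_gen σ)
    rw [Submodule.map_toAddSubgroup, ← Finset.coe_image] at this
    exact this
  · have := congrArg Submodule.toAddSubgroup (q.map_push_lat G)
    rw [Submodule.map_toAddSubgroup] at this
    exact this

theorem IsIsoOn.cls_image {q : FactorMap c d} {E : Face c} (h : q.IsIsoOn E)
    {σ : Finset (Vertex c)} (hσ : (σ : Set (Vertex c)) ⊆ E.verts) :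
    (q.onFace E).cls (σ.image q.onVertex) = E.cls σ := by
  have h1 : E.lat.toAddSubgroup ⊓ q.push.toAddMonoidHom.ker = ⊥ := by
    rw [eq_bot_iff]
    rintro x ⟨hx, hx'⟩
    exact h.push_eq_zero hx hx'
  rw [q.cls_eq_mul hσ, h1, AddSubgroup.relIndex_bot_right, mul_one]

end FactorMap

/-- Any vertex has height 1, so both lattices project onto all of `ℤ` and the index is carried by
their height-zero parts. This matters because the kernel of a collapse contains only vectors of
height zero. -/
theorem cls_eq_relIndex_inf_ker_fst {H : Face c} {ρ : Finset (Vertex c)}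
    (hρ : (ρ : Set (Vertex c)) ⊆ H.verts) (hne : ρ.Nonempty) :
    H.cls ρ = ((gen (ρ : Set (Vertex c))).toAddSubgroup ⊓ (AddMonoidHom.fst ℤ _).ker).relIndex
      (H.lat.toAddSubgroup ⊓ (AddMonoidHom.fst ℤ _).ker) := by
  obtain ⟨v, hv⟩ := hne
  have key : ∀ L : Submodule ℤ (Amb c), vec v ∈ L →
      L.toAddSubgroup.map (AddMonoidHom.fst ℤ _) = ⊤ := by
    intro L hL
    rw [eq_top_iff]
    intro n _
    exact ⟨n • vec v, L.smul_mem n hL, by simp [vec]⟩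
  rw [Face.cls, relIndex_eq_map_mul_inf_ker (AddMonoidHom.fst ℤ _) (gen_le_lat hρ),
    key _ (vec_mem_gen (S := (ρ : Set (Vertex c))) hv), key _ (vec_mem_lat_iff.2 (hρ hv)),
    AddSubgroup.relIndex_self, one_mul]

theorem lat_inf_lat {E G H : Face c} (hH : ∀ i, H.support i = G.support i ∩ E.support i) :
    G.lat ⊓ E.lat = H.lat := by
  ext x
  rw [Submodule.mem_inf, Face.mem_lat, Face.mem_lat, Face.mem_lat]
  simp only [hH, Finset.mem_inter, not_and_or]
  constructor
  · rintro ⟨⟨h1, h2⟩, -, h3⟩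
    exact ⟨h1, fun i j hj => hj.elim (h2 i j) (h3 i j)⟩
  · rintro ⟨h1, h2⟩
    exact ⟨⟨h1, fun i j hj => h2 i j (.inl hj)⟩, h1, fun i j hj => h2 i j (.inr hj)⟩

end FactorMap

/-! ### Contracting a face -/

section Collapse

variable {ι κ : Type} {c : ι → ℕ} {d : κ → ℕ}

namespace FactorMap.IsCollapse

variable {q : FactorMap c d} {E : Face c}

theorem lat_inf_ker (h : q.IsCollapse E) (G : Face c) :
    G.lat.toAddSubgroup ⊓ q.push.toAddMonoidHom.ker =
      (G.lat ⊓ E.lat).toAddSubgroup ⊓ (AddMonoidHom.fst ℤ _).ker := by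
  ext x
  constructor
  · rintro ⟨hx, hx'⟩
    obtain ⟨h1, h2⟩ := (h.push_eq_zero_iff hx.1).1 hx'
    exact ⟨⟨hx, h1⟩, h2⟩
  · rintro ⟨⟨hx, h1⟩, h2⟩
    exact ⟨hx, (h.push_eq_zero_iff h1.1).2 ⟨h1, h2⟩⟩

/-- The common part with `E` becomes one point and the rest stays injective, so the dimension drops
by that of the intersection. -/
theorem card_image_support_of_inter {G : Face c} (h : q.IsCollapse E) (k : κ)
    (hne : (G.support (q.idx k) ∩ E.support (q.idx k)).Nonempty) :
    ((q.onFace G).support k).card + (G.support (q.idx k) ∩ E.support (q.idx k)).card =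
      (G.support (q.idx k)).card + 1 := by
  obtain ⟨y, hy⟩ := h.apply_eq k
  set S := G.support (q.idx k)
  set T := E.support (q.idx k)
  have h1 : S.image (q.toFun k) = insert y ((S \ T).image (q.toFun k)) := by
    ext z
    rw [Finset.mem_image, Finset.mem_insert, Finset.mem_image]
    constructor
    · rintro ⟨j, hj, rfl⟩
      by_cases hjT : j ∈ T
      · exact .inl ((hy j).2 hjT)
      · exact .inr ⟨j, Finset.mem_sdiff.2 ⟨hj, hjT⟩, rfl⟩
    · rintro (rfl | ⟨j, hj, rfl⟩)
      · obtain ⟨j, hj⟩ := hne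
        rw [Finset.mem_inter] at hj
        exact ⟨j, hj.1, (hy j).2 hj.2⟩
      · exact ⟨j, (Finset.mem_sdiff.1 hj).1, rfl⟩
  have h2 : y ∉ (S \ T).image (q.toFun k) := by
    intro hmem
    obtain ⟨j, hj, hjy⟩ := Finset.mem_image.1 hmem
    exact (Finset.mem_sdiff.1 hj).2 ((hy j).1 hjy)
  have h3 : ((S \ T).image (q.toFun k)).card = (S \ T).card :=
    Finset.card_image_of_injOn fun a ha b hb hab =>
      h.injOn k (Finset.mem_sdiff.1 ha).2 (Finset.mem_sdiff.1 hb).2 hab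
  change (S.image (q.toFun k)).card + _ = _
  rw [h1, Finset.card_insert_of_notMem h2, h3]
  have := Finset.card_sdiff_add_card_inter S T
  omega

theorem card_image_support_of_inter_subsingleton {G : Face c} (h : q.IsCollapse E) (k : κ)
    (hs : (G.support (q.idx k) ∩ E.support (q.idx k)).card ≤ 1) :
    ((q.onFace G).support k).card = (G.support (q.idx k)).card := by
  refine Finset.card_image_of_injOn fun a ha b hb hab => ?_
  obtain ⟨y, hy⟩ := h.apply_eq k
  by_cases haE : a ∈ E.support (q.idx k)
  · have hbE : b ∈ E.support (q.idx k) := (hy b).1 (hab ▸ (hy a).2 haE)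
    exact Finset.card_le_one.1 hs a (Finset.mem_inter.2 ⟨ha, haE⟩) b (Finset.mem_inter.2 ⟨hb, hbE⟩)
  · have hbE : b ∉ E.support (q.idx k) := fun hbE => haE ((hy a).1 (hab.trans ((hy b).2 hbE)))
    exact h.injOn k haE hbE hab

theorem onFace_whole (h : q.IsCollapse E) : q.onFace (Face.whole c) = Face.whole d := by
  rw [onFace, Face.whole]
  congr
  funext k
  exact Finset.image_univ_of_surjective (h.surjective k)

variable [Fintype ι] [Fintype κ]

theorem rk_add_rk {G H : Face c} (h : q.IsCollapse E)
    (hH : ∀ i, H.support i = G.support i ∩ E.support i) :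
    (q.onFace G).rk + H.rk = G.rk + 1 := by
  have h1 : ∑ k, (((q.onFace G).support k).card - 1) =
      ∑ i, ((G.support i).card - (H.support i).card) := by
    refine Fintype.sum_of_injective q.idx q.idx_injective _ _ (fun i hi => ?_) fun k => ?_
    · rw [hH, h.support_eq i hi, Finset.inter_univ, Nat.sub_self]
    · have h2 := h.card_image_support_of_inter (G := G) k (hH _ ▸ H.nonempty _)
      rw [← hH] at h2
      have h3 := (H.nonempty (q.idx k)).card_pos
      omega
  have h2 : ∑ i, ((G.support i).card - (H.support i).card) + ∑ i, ((H.support i).card - 1) =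
      ∑ i, ((G.support i).card - 1) := by
    rw [← Finset.sum_add_distrib]
    refine Finset.sum_congr rfl fun i _ => ?_
    have h3 := (H.nonempty i).card_pos
    have h4 : (H.support i).card ≤ (G.support i).card :=
      Finset.card_le_card (hH i ▸ Finset.inter_subset_left)
    omega
  simp only [Face.rk]
  omega

variable [DecidableEq ι] [DecidableEq κ] {α σ τ : Finset (Vertex c)} {G H : Face c}

/-- The faces `G` and `E` meet in the face `H`. -/
theorem cls_of_inter (h : q.IsCollapse E) (hα : LinearIndepOn ℤ vec (α : Set (Vertex c)))
    (hτα : τ ⊆ α) (hτE : (τ : Set (Vertex c)) ⊆ E.verts) (hτ : E.cls τ ≠ 0)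
    (hσα : σ ⊆ α) (hσG : (σ : Set (Vertex c)) ⊆ G.verts) (hσ : G.cls σ ≠ 0)
    (hH : ∀ i, H.support i = G.support i ∩ E.support i) :
    ((σ ∩ τ : Finset _) : Set (Vertex c)) ⊆ H.verts ∧ (σ ∩ τ).card = H.rk ∧
      G.cls σ = (q.onFace G).cls (σ.image q.onVertex) * H.cls (σ ∩ τ) := by
  have h1 : ((σ ∩ τ : Finset _) : Set (Vertex c)) ⊆ H.verts := by
    intro v hv i
    rw [Finset.coe_inter] at hv
    rw [hH]
    exact Finset.mem_inter.2 ⟨hσG hv.1 i, hτE hv.2 i⟩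
  have hgen := gen_inf_lat hα hσα hτα hτE hτ
  rw [← Finset.coe_inter] at hgen
  -- Finite index is preserved by intersecting both lattices with that of `E`, and `gen_inf_lat`
  -- shows that the smaller one becomes the lattice of `σ ∩ τ`.
  have h2 : H.cls (σ ∩ τ) ≠ 0 := by
    rw [Face.cls, ← lat_inf_lat hH, ← hgen]
    exact AddSubgroup.relIndex_inter_ne_zero hσ E.lat.toAddSubgroup
  have h3 : (σ ∩ τ).card = H.rk :=
    card_eq_rk_of_cls_ne_zero
      (hα.mono (by exact_mod_cast Finset.inter_subset_left.trans hσα)) h1 h2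
  have hne : (σ ∩ τ).Nonempty := by
    rw [← Finset.card_pos, h3]; exact Nat.succ_pos _
  refine ⟨h1, h3, ?_⟩
  rw [q.cls_eq_mul hσG, cls_eq_relIndex_inf_ker_fst h1 hne]
  congr 2
  · have : (gen (σ : Set (Vertex c))).toAddSubgroup ⊓ q.push.toAddMonoidHom.ker =
        (gen (σ : Set (Vertex c))).toAddSubgroup ⊓
          (G.lat.toAddSubgroup ⊓ q.push.toAddMonoidHom.ker) := by
      rw [← inf_assoc]
      congr 1
      exact (inf_eq_left.2 (Submodule.toAddSubgroup_mono (gen_le_lat hσG))).symm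
    rw [this, h.lat_inf_ker, ← inf_assoc, ← hgen]
    congr 1
    ext x
    constructor
    · rintro ⟨hx, -, hx'⟩; exact ⟨hx, hx'⟩
    · rintro ⟨hx, hx'⟩; exact ⟨hx, gen_le_lat hσG hx, hx'⟩
  · rw [h.lat_inf_ker, lat_inf_lat hH]

/-- The faces `G` and `E` are disjoint. -/
theorem cls_of_disjoint (h : q.IsCollapse E) (hα : LinearIndepOn ℤ vec (α : Set (Vertex c)))
    (hτα : τ ⊆ α) (hτE : (τ : Set (Vertex c)) ⊆ E.verts) (hτ : E.cls τ ≠ 0)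
    (hσα : σ ⊆ α) (hσG : (σ : Set (Vertex c)) ⊆ G.verts) (hσ : G.cls σ ≠ 0)
    (hdisj : ∃ i, G.support i ∩ E.support i = ∅) :
    (∀ i, (G.support i ∩ E.support i).card ≤ 1) ∧
      G.cls σ = (q.onFace G).cls (σ.image q.onVertex) := by
  have h1 : (σ : Set (Vertex c)) ∩ τ = ∅ := by
    rw [Set.eq_empty_iff_forall_notMem]
    rintro v ⟨hv, hv'⟩
    obtain ⟨i, hi⟩ := hdisj
    have := Finset.mem_inter.2 ⟨hσG hv i, hτE hv' i⟩
    rw [hi] at this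
    exact Finset.notMem_empty _ this
  have hgen := gen_inf_lat hα hσα hτα hτE hτ
  have hbot : gen (∅ : Set (Vertex c)) = ⊥ := by rw [gen, Set.image_empty, Submodule.span_empty]
  rw [h1, hbot] at hgen
  have h2 : (gen (σ : Set (Vertex c))).toAddSubgroup ⊓ q.push.toAddMonoidHom.ker = ⊥ := by
    rw [eq_bot_iff]
    rintro x ⟨hx, hx'⟩
    have hxE := ((h.push_eq_zero_iff (gen_le_lat hσG hx).1).1 hx').1
    have : x ∈ gen (σ : Set (Vertex c)) ⊓ E.lat := ⟨hx, hxE⟩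
    rwa [hgen] at this
  have hmul := q.cls_eq_mul hσG
  rw [h2, AddSubgroup.relIndex_bot_left] at hmul
  -- The kernel part of the lattice of `σ` is trivial, so the index is the order of the kernel part
  -- of `G.lat`. A nonzero class makes that order finite, and a finite torsion-free group is
  -- trivial.
  have h3 : ∀ x ∈ G.lat.toAddSubgroup ⊓ q.push.toAddMonoidHom.ker, x = 0 := by
    intro x hx
    have h0 : Nat.card (G.lat.toAddSubgroup ⊓ q.push.toAddMonoidHom.ker : AddSubgroup (Amb c)) ≠ 0 :=
      fun h0 => hσ (by rw [hmul, h0, mul_zero])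
    have := congrArg Subtype.val (card_nsmul_eq_zero'
      (x := (⟨x, hx⟩ : (G.lat.toAddSubgroup ⊓ q.push.toAddMonoidHom.ker : AddSubgroup (Amb c)))))
    exact (smul_eq_zero.1 this).resolve_left h0
  constructor
  · intro i
    rw [Finset.card_le_one]
    intro a ha b hb
    rw [Finset.mem_inter] at ha hb
    obtain ⟨v, hv⟩ := G.exists_mem_verts
    have hva : ∀ a ∈ G.support i, Function.update v i a ∈ G.verts := by
      intro a ha i'
      by_cases hi : i' = i
      · subst hi; simpa using ha
      · simpa [hi] using hv i'
    -- Two distinct common vertices in one factor would give a nonzero difference in the kernel.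
    have hx : vec (Function.update v i a) - vec (Function.update v i b) ∈ G.lat :=
      sub_mem (vec_mem_lat_iff.2 (hva a ha.1)) (vec_mem_lat_iff.2 (hva b hb.1))
    have hx0 := h3 _ ⟨hx, (h.push_eq_zero_iff hx.1).2 ⟨⟨hx.1, fun i' j hj => ?_⟩, by simp [vec]⟩⟩
    · have := congrFun (congrFun (congrArg Prod.snd hx0) i) a
      by_contra hne
      simp [vec, hne] at this
    · by_cases hi : i' = i
      · subst hi
        have hja : j ≠ a := fun e => hj (e ▸ ha.2)
        have hjb : j ≠ b := fun e => hj (e ▸ hb.2)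
        simp [vec, hja, hjb]
      · simp [vec, hi]
  · have : G.lat.toAddSubgroup ⊓ q.push.toAddMonoidHom.ker = ⊥ := by
      rw [eq_bot_iff]; exact fun x hx => h3 x hx
    rw [hmul, this, AddSubgroup.card_bot, mul_one]

/-- A simplex with a face spanning `E` is contracted to a simplex. -/
theorem contract_simplex (h : q.IsCollapse E) (hα : LinearIndepOn ℤ vec (α : Set (Vertex c)))
    (hcard : α.card = (Face.whole c).rk) (hc : (Face.whole c).cls α ≠ 0)
    (hτα : τ ⊆ α) (hτE : (τ : Set (Vertex c)) ⊆ E.verts) (hτ : E.cls τ ≠ 0) :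
    (Face.whole c).cls α = (Face.whole d).cls (α.image q.onVertex) * E.cls τ ∧
    (α.image q.onVertex).card = (Face.whole d).rk ∧
    Set.InjOn q.onVertex ((α \ τ : Finset _) : Set (Vertex c)) ∧
    ∃ u, (∀ v ∈ E.verts, q.onVertex v = u) ∧ ∀ v ∈ α \ τ, q.onVertex v ≠ u := by
  have hE : ∀ i, E.support i = (Face.whole c).support i ∩ E.support i :=
    fun i => (Finset.univ_inter _).symm
  obtain ⟨-, h1, h2⟩ := h.cls_of_inter hα hτα hτE hτ subset_rfl
    (fun v _ i => Finset.mem_univ _) hc hE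
  rw [Finset.inter_eq_right.2 hτα] at h1 h2
  have hrk := h.rk_add_rk hE
  rw [h.onFace_whole] at h2 hrk
  obtain ⟨u, hu⟩ := h.exists_vertex
  have himage : α.image q.onVertex ⊆ insert u ((α \ τ).image q.onVertex) := by
    intro z hz
    obtain ⟨v, hv, rfl⟩ := Finset.mem_image.1 hz
    by_cases hvτ : v ∈ τ
    · rw [(hu v).2 (hτE hvτ)]; exact Finset.mem_insert_self _ _
    · exact Finset.mem_insert_of_mem (Finset.mem_image_of_mem _ (Finset.mem_sdiff.2 ⟨hv, hvτ⟩))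
  -- The rank bounds the image from below, and `|α \ τ| + 1` bounds it from above by the same
  -- number. Equality throughout forces injectivity off `τ` and keeps `u` out of the image of `α \
  -- τ`.
  have hle1 : (Face.whole d).rk ≤ (α.image q.onVertex).card :=
    rk_le_card_of_cls_ne_zero fun h0 => hc (by rw [h2, h0, zero_mul])
  have hle2 := Finset.card_le_card himage
  have hle3 := Finset.card_insert_le u ((α \ τ).image q.onVertex)
  have hle4 := Finset.card_image_le (s := α \ τ) (f := q.onVertex)
  have hle5 := Finset.card_sdiff_add_card_eq_card hτα
  refine ⟨h2, by omega, ?_, u, fun v hv => (hu v).2 hv, fun v hv hvu => ?_⟩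
  · rw [← Finset.card_image_iff]; omega
  · have := Finset.card_insert_of_mem
      (Finset.mem_image.2 ⟨v, hv, hvu⟩ : u ∈ (α \ τ).image q.onVertex)
    omega

end FactorMap.IsCollapse

end Collapse

/-! ### Contractions and charts of faces of products of segments and triangles -/

/-- Applied to the dimensions of a face it indexes a chart, applied to codimensions it indexes a
contraction; factors of dimension zero are dropped. -/
theorem exists_starDims_index {ι : Type} [Fintype ι] {n : ι → ℕ} (hn : ∀ i, n i ≤ 2) {a b : ℕ}
    (ha : (Finset.univ.filter fun i => n i = 1).card = a)
    (hb : (Finset.univ.filter fun i => n i = 2).card = b) :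
    ∃ m : Fin a ⊕ Fin b → ι, Function.Injective m ∧ (∀ x, n (m x) = starDims a b x) ∧
      ∀ i ∉ Set.range m, n i = 0 := by
  let e1 := Finset.equivFinOfCardEq ha
  let e2 := Finset.equivFinOfCardEq hb
  have h1 : ∀ x, n (e1.symm x) = 1 := fun x => (Finset.mem_filter.1 (e1.symm x).2).2
  have h2 : ∀ x, n (e2.symm x) = 2 := fun x => (Finset.mem_filter.1 (e2.symm x).2).2
  refine ⟨Sum.elim (fun x => e1.symm x) (fun x => e2.symm x), ?_, ?_, ?_⟩
  · refine (Subtype.val_injective.comp e1.symm.injective).sumElim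
      (Subtype.val_injective.comp e2.symm.injective) fun x y hxy => ?_
    have := congrArg n hxy
    simp [h1, h2] at this
  · rintro (x | x)
    · exact h1 x
    · exact h2 x
  · intro i hi
    by_contra h0
    have : n i = 1 ∨ n i = 2 := by have := hn i; omega
    rcases this with h | h
    · exact hi ⟨.inl (e1 ⟨i, by simp [h]⟩), by simp⟩
    · exact hi ⟨.inr (e2 ⟨i, by simp [h]⟩), by simp⟩

theorem exists_injOn_image_eq_univ {A : Type*} [DecidableEq A] {S : Finset A} {n : ℕ}
    (h : S.card = n + 1) : ∃ f : A → Fin (n + 1), Set.InjOn f S ∧ S.image f = Finset.univ := by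
  let e := Finset.equivFinOfCardEq h
  refine ⟨fun a => if ha : a ∈ S then e ⟨a, ha⟩ else 0, fun a ha b hb hab => ?_, ?_⟩
  · simp only [Finset.mem_coe] at ha hb
    simpa [ha, hb] using hab
  · rw [Finset.eq_univ_iff_forall]
    intro y
    exact Finset.mem_image.2 ⟨e.symm y, (e.symm y).2, by simp⟩

theorem exists_contraction {A : Type*} [Fintype A] [DecidableEq A] {S : Finset A}
    (hS : S.Nonempty) {n : ℕ} (h : S.card + n = Fintype.card A) :
    ∃ f : A → Fin (n + 1), (∃ y, ∀ j, f j = y ↔ j ∈ S) ∧ Set.InjOn f {j | j ∉ S} ∧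
      Function.Surjective f := by
  have hc : Sᶜ.card = n := by rw [Finset.card_compl]; omega
  let e := Finset.equivFinOfCardEq hc
  refine ⟨fun a => if ha : a ∈ S then 0 else (e ⟨a, Finset.mem_compl.2 ha⟩).succ,
    ⟨0, fun j => ?_⟩, fun a ha b hb hab => ?_, fun y => ?_⟩
  · by_cases hj : j ∈ S <;> simp [hj, Fin.succ_ne_zero]
  · simp only [Set.mem_ofPred_eq] at ha hb
    simpa [ha, hb] using hab
  · refine Fin.cases ?_ (fun z => ?_) y
    · obtain ⟨a, ha⟩ := hS
      exact ⟨a, by simp [ha]⟩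
    · have := Finset.mem_compl.1 (e.symm z).2
      exact ⟨e.symm z, by simp [this]⟩

theorem vertexPoint_mem_carrier {ι : Type} {c : ι → ℕ} {E : Face c} {v : Vertex c} :
    vertexPoint v ∈ E.carrier ↔ v ∈ E.verts := by
  constructor
  · intro h i
    by_contra hi
    simpa [vertexPoint] using h.2 i _ hi
  · intro h
    refine ⟨fun i => single_mem_stdSimplex ℝ (v i), fun i j hj => ?_⟩
    have : j ≠ v i := fun e => hj (e ▸ h i)
    simp [vertexPoint, this]

section Charts

variable {ι : Type} [Fintype ι] {c : ι → ℕ}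

theorem Face.IsPi.card_sub_one {E : Face c} {a b : ℕ} (h : E.IsPi a b) :
    (Finset.univ.filter fun i => (E.support i).card - 1 = 1).card = a ∧
      (Finset.univ.filter fun i => (E.support i).card - 1 = 2).card = b := by
  obtain ⟨-, rfl, rfl⟩ := h
  constructor <;>
  · congr 1
    ext i
    have := (E.nonempty i).card_pos
    simp only [Finset.mem_filter, Finset.mem_univ, true_and]
    omega

theorem exists_isIsoOn {E : Face c} {a b : ℕ} (hE : E.IsPi a b) :
    ∃ q : FactorMap c (starDims a b), q.IsIsoOn E ∧ q.onFace E = Face.whole _ := by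
  have hpos := fun i => (E.nonempty i).card_pos
  obtain ⟨m, hm, hmd, hm0⟩ := exists_starDims_index (n := fun i => (E.support i).card - 1)
    (fun i => by have := hE.1 i; omega)
    hE.card_sub_one.1 hE.card_sub_one.2
  have hf : ∀ x, ∃ f : Fin (c (m x) + 1) → Fin (starDims a b x + 1),
      Set.InjOn f (E.support (m x)) ∧ (E.support (m x)).image f = Finset.univ := fun x =>
    exists_injOn_image_eq_univ (by have := hmd x; have := hpos (m x); omega)
  choose f hf hf' using hf
  refine ⟨⟨m, hm, f⟩, ⟨hf, fun i hi => ?_⟩, ?_⟩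
  · have := hm0 i hi; have := hpos i; omega
  · rw [FactorMap.onFace, Face.whole]
    congr
    exact funext hf'

theorem exists_isCollapse (hc : ∀ i, c i ≤ 2) (E : Face c) {a b : ℕ}
    (ha : (Finset.univ.filter fun i => c i - ((E.support i).card - 1) = 1).card = a)
    (hb : (Finset.univ.filter fun i => c i - ((E.support i).card - 1) = 2).card = b) :
    ∃ q : FactorMap c (starDims a b), q.IsCollapse E := by
  have hpos := fun i => (E.nonempty i).card_pos
  have hle : ∀ i, (E.support i).card ≤ c i + 1 := fun i => by
    simpa using Finset.card_le_univ (E.support i)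
  obtain ⟨m, hm, hmd, hm0⟩ := exists_starDims_index
    (n := fun i => c i - ((E.support i).card - 1))
    (fun i => by have := hc i; omega) ha hb
  have hf : ∀ x, ∃ f : Fin (c (m x) + 1) → Fin (starDims a b x + 1),
      (∃ y, ∀ j, f j = y ↔ j ∈ E.support (m x)) ∧ Set.InjOn f {j | j ∉ E.support (m x)} ∧
        Function.Surjective f := fun x =>
    exists_contraction (E.nonempty _) (by
      rw [Fintype.card_fin]
      have := hmd x; have := hpos (m x); have := hle (m x); omega)
  choose f h1 h2 h3 using hf
  refine ⟨⟨m, hm, f⟩, h1, h2, h3, fun i hi => ?_⟩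
  rw [← Finset.card_eq_iff_eq_univ, Fintype.card_fin]
  have := hm0 i hi; have := hpos i; have := hle i; omega

theorem isPi_onFace {κ : Type} [Fintype κ] {d : κ → ℕ} {q : FactorMap c d} {G : Face c}
    {n : ι → ℕ} (hn : ∀ i, n i ≤ 2) (h : ∀ k, ((q.onFace G).support k).card = n (q.idx k) + 1)
    (h0 : ∀ i ∉ Set.range q.idx, n i = 0) :
    (q.onFace G).IsPi (Finset.univ.filter fun i => n i = 1).card
      (Finset.univ.filter fun i => n i = 2).card := by
  refine ⟨fun k => by rw [h]; have := hn (q.idx k); omega, ?_, ?_⟩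
  all_goals
    rw [Finset.card_filter, Finset.card_filter]
    refine Fintype.sum_of_injective q.idx q.idx_injective _ _ (fun i hi => ?_) fun k => ?_
    · simp [h0 i hi]
    · rw [h]; simp

theorem Face.IsPi.rk_eq {E : Face c} {a b : ℕ} (h : E.IsPi a b) : E.rk = a + 2 * b + 1 := by
  obtain ⟨h3, rfl, rfl⟩ := h
  rw [Face.rk, Finset.card_filter, Finset.card_filter, Finset.mul_sum, ← Finset.sum_add_distrib]
  congr 1
  refine Finset.sum_congr rfl fun i _ => ?_
  have := h3 i
  have := (E.nonempty i).card_pos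
  split_ifs <;> omega

theorem isExteriorFace_iff [DecidableEq ι] {α τ : Finset (Vertex c)} {a b : ℕ} {k : ℝ} :
    IsExteriorFace α a b k τ ↔ τ ⊆ α ∧ ∃ E : Face c, E.IsPi a b ∧
      (τ : Set (Vertex c)) ⊆ E.verts ∧ τ.card = E.rk ∧ (E.cls τ : ℝ) = k := by
  constructor
  · rintro ⟨h1, h2, E, h3, h4, h5⟩
    have h6 : (τ : Set (Vertex c)) ⊆ E.verts := fun v hv => vertexPoint_mem_carrier.1 (h4 v hv)
    obtain ⟨h7, h8⟩ := (hasClass_iff h6).1 h5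
    exact ⟨h1, E, h3, h6, h7, h8⟩
  · rintro ⟨h1, E, h3, h6, h7, h8⟩
    exact ⟨h1, by rw [h7, h3.rk_eq], E, h3, fun v hv => vertexPoint_mem_carrier.2 (h6 hv),
      (hasClass_iff h6).2 ⟨h7, h8⟩⟩

end Charts

/-! ### Counting factors -/

section Counting

variable {ι : Type} [Fintype ι] {x y : ι → ℕ}

/-- Here `x ≤ y ≤ 2` are the factor dimensions of a face inside a larger one. A triangle containing
an edge leaves a segment after contraction, which produces the terms `2w` and `2e` in the bound. -/
theorem card_sub_eq_one (hy : ∀ i, y i ≤ 2) (hxy : ∀ i, x i ≤ y i) :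
    (Finset.univ.filter fun i => y i - x i = 1).card + (Finset.univ.filter fun i => x i = 1).card =
      (Finset.univ.filter fun i => y i = 1).card +
        2 * (Finset.univ.filter fun i => y i = 2 ∧ x i = 1).card := by
  simp only [Finset.card_filter, two_mul, ← Finset.sum_add_distrib]
  refine Finset.sum_congr rfl fun i _ => ?_
  have := hy i; have := hxy i
  split_ifs <;> omega

theorem card_sub_eq_two (hy : ∀ i, y i ≤ 2) (hxy : ∀ i, x i ≤ y i) :
    (Finset.univ.filter fun i => y i - x i = 2).card + (Finset.univ.filter fun i => x i = 2).card +
        (Finset.univ.filter fun i => y i = 2 ∧ x i = 1).card =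
      (Finset.univ.filter fun i => y i = 2).card := by
  simp only [Finset.card_filter, ← Finset.sum_add_distrib]
  refine Finset.sum_congr rfl fun i _ => ?_
  have := hy i; have := hxy i
  split_ifs <;> omega

theorem card_eq_one_le (hy : ∀ i, y i ≤ 2) (hxy : ∀ i, x i ≤ y i) :
    (Finset.univ.filter fun i => x i = 1).card ≤ (Finset.univ.filter fun i => y i = 1).card +
        (Finset.univ.filter fun i => y i = 2 ∧ x i = 1).card := by
  simp only [Finset.card_filter, ← Finset.sum_add_distrib]
  refine Finset.sum_le_sum fun i _ => ?_
  have := hy i; have := hxy i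
  split_ifs <;> omega

theorem card_two_one_le :
    (Finset.univ.filter fun i => y i = 2 ∧ x i = 1).card ≤
      (Finset.univ.filter fun i => x i = 1).card :=
  Finset.card_le_card fun i hi => by simp_all

theorem card_one_add_card_two_le (hy : ∀ i, y i ≤ 2) (hxy : ∀ i, x i ≤ y i) :
    (Finset.univ.filter fun i => x i = 1).card + (Finset.univ.filter fun i => x i = 2).card ≤
      (Finset.univ.filter fun i => y i = 1).card +
        (Finset.univ.filter fun i => y i = 2).card := by
  simp only [Finset.card_filter, ← Finset.sum_add_distrib]
  refine Finset.sum_le_sum fun i _ => ?_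
  have := hy i; have := hxy i
  split_ifs <;> omega

theorem card_one_add_card_one_zero (hy : ∀ i, y i ≤ 2) (hxy : ∀ i, x i ≤ y i) :
    (Finset.univ.filter fun i => y i = 2 ∧ x i = 1).card +
        (Finset.univ.filter fun i => y i = 1).card =
      (Finset.univ.filter fun i => x i = 1).card +
        (Finset.univ.filter fun i => y i = 1 ∧ x i = 0).card := by
  simp only [Finset.card_filter, ← Finset.sum_add_distrib]
  refine Finset.sum_congr rfl fun i _ => ?_
  have := hy i; have := hxy i
  split_ifs <;> omega

end Counting

theorem card_starDims (s t : ℕ) :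
    (Finset.univ.filter fun i => starDims s t i = 1).card = s ∧
      (Finset.univ.filter fun i => starDims s t i = 2).card = t := by
  simp only [Finset.card_filter, Fintype.sum_sum_type]
  simp [starDims]

/-! ### Exterior faces of a simplex and of its contraction -/

/-- The integers `A`, `B` are tied to `a`, `b` only by equations, so that expressions such as `s' -
s + 2e` can be supplied with an arithmetic proof. -/
theorem exteriorCount_le_F {a b : ℕ} {A B : ℤ} (hA : A = a) (hB : B = b)
    {α : Finset (Vertex (starDims a b))} {c : ℝ} (hc : 1 ≤ c)
    (hα : HasClass (Face.whole _) α c) {m n : ℤ} (hm : 0 ≤ m) (hn : 0 ≤ n) {k : ℝ} (hk : 1 ≤ k) :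
    exteriorCount α m.toNat n.toNat k ≤ F A B c m n k := by
  classical
  subst hA hB
  rw [F, if_pos ⟨Int.natCast_nonneg _, Int.natCast_nonneg _, hm, hn, hc, hk⟩]
  refine Finset.le_sup (f := fun α : Finset (Vertex (starDims a b)) =>
    exteriorCount α m.toNat n.toNat k) ?_
  rw [Finset.mem_filter]
  exact ⟨Finset.mem_univ _,
    isSimplex_of_hasClass hα (by positivity), hα⟩

theorem Face.inter_card_sub_one {ι : Type} {c : ι → ℕ} (G E : Face c) (i : ι) :
    (G.support i ∩ E.support i).card - 1 ≤ (G.support i).card - 1 :=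
  Nat.sub_le_sub_right (Finset.card_le_card Finset.inter_subset_left) 1

/-! ### Encoding an exterior face by its trace and its image -/

section Pairs

variable {ι : Type} [Fintype ι] {c : ι → ℕ}

/-- The part of a set of vertices `σ` in `τ`, replaced by a fixed vertex if it is empty. -/
def trace (τ : Finset (Vertex c)) (a : Vertex c) (σ : Finset (Vertex c)) : Finset (Vertex c) :=
  if (σ ∩ τ).Nonempty then σ ∩ τ else {a}

theorem trace_subset {τ : Finset (Vertex c)} {a : Vertex c} (ha : a ∈ τ)
    (σ : Finset (Vertex c)) : trace τ a σ ⊆ τ := by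
  rw [trace]
  split_ifs
  · exact Finset.inter_subset_right
  · simpa using ha

variable {κ μ : Type} [Fintype κ] {d : κ → ℕ} [Fintype μ] {f : μ → ℕ}

/-- A set of vertices is determined by its trace on a face and its image under the contraction
of that face. -/
theorem eq_of_trace_of_image {q : FactorMap c d} {p : FactorMap c f} {E : Face c}
    (hp : p.IsIsoOn E) {α τ : Finset (Vertex c)} (hτE : (τ : Set (Vertex c)) ⊆ E.verts)
    (hq : Set.InjOn q.onVertex ((α \ τ : Finset _) : Set (Vertex c))) {u : Vertex d}
    (hu : ∀ v ∈ τ, q.onVertex v = u) (hu' : ∀ v ∈ α \ τ, q.onVertex v ≠ u)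
    {a : Vertex c} (ha : a ∈ τ) {σ ρ : Finset (Vertex c)} (hσ : σ ⊆ α) (hρ : ρ ⊆ α)
    (h1 : (trace τ a σ).image p.onVertex = (trace τ a ρ).image p.onVertex)
    (h2 : σ.image q.onVertex = ρ.image q.onVertex) : σ = ρ := by
  have htr : trace τ a σ = trace τ a ρ := by
    refine Finset.coe_injective (hp.onVertex_injOn.image_eq_image_iff ?_ ?_ |>.1 ?_)
    · exact (Finset.coe_subset.2 (trace_subset ha σ)).trans hτE
    · exact (Finset.coe_subset.2 (trace_subset ha ρ)).trans hτE
    · rw [← Finset.coe_image, h1, Finset.coe_image]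
  have key : ∀ {σ ρ : Finset (Vertex c)}, σ ⊆ α → ρ ⊆ α → trace τ a σ = trace τ a ρ →
      σ.image q.onVertex = ρ.image q.onVertex → σ ⊆ ρ := by
    intro σ ρ hσ hρ htr him v hv
    have hmem : q.onVertex v ∈ ρ.image q.onVertex := him ▸ Finset.mem_image_of_mem _ hv
    obtain ⟨w, hw, hwv⟩ := Finset.mem_image.1 hmem
    by_cases hvτ : v ∈ τ
    · have hwτ : w ∈ τ := by
        by_contra hwτ
        exact hu' w (Finset.mem_sdiff.2 ⟨hρ hw, hwτ⟩) (hwv.trans (hu v hvτ))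
      rw [trace, trace, if_pos ⟨v, Finset.mem_inter.2 ⟨hv, hvτ⟩⟩,
        if_pos ⟨w, Finset.mem_inter.2 ⟨hw, hwτ⟩⟩] at htr
      have : v ∈ ρ ∩ τ := htr ▸ Finset.mem_inter.2 ⟨hv, hvτ⟩
      exact (Finset.mem_inter.1 this).1
    · have hwτ : w ∉ τ := fun hwτ =>
        hu' v (Finset.mem_sdiff.2 ⟨hσ hv, hvτ⟩) (hwv.symm.trans (hu w hwτ))
      have := hq (Finset.mem_coe.2 (Finset.mem_sdiff.2 ⟨hρ hw, hwτ⟩))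
        (Finset.mem_coe.2 (Finset.mem_sdiff.2 ⟨hσ hv, hvτ⟩)) hwv
      exact this ▸ hw
  exact (key hσ hρ htr h2).antisymm (key hρ hσ htr.symm h2.symm)

variable [DecidableEq ι] [DecidableEq κ] [DecidableEq μ]

/-- The trace of an exterior face on a face `E`, and its image under the contraction of `E`. -/
theorem exists_exterior_pair {q : FactorMap c d} {p : FactorMap c f} {E G : Face c} (hq : q.IsCollapse E) (hp : p.IsIsoOn E) {α τ σ : Finset (Vertex c)} (hα : LinearIndepOn ℤ vec (α : Set (Vertex c)))
    (hτα : τ ⊆ α) (hτE : (τ : Set (Vertex c)) ⊆ E.verts) (hτ : E.cls τ ≠ 0)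
    {a : Vertex c} (ha : a ∈ τ) (hσα : σ ⊆ α) (hσG : (σ : Set (Vertex c)) ⊆ G.verts)
    (hσ : G.cls σ ≠ 0) {s t : ℕ} (hG : G.IsPi s t) (hσcard : σ.card = G.rk)
    {x : ι → ℕ} (hx : ∀ i, x i = (G.support i ∩ E.support i).card - 1) {A B : ℕ}
    (hA : (Finset.univ.filter fun i => ((G.support i).card - 1) - x i = 1).card = A)
    (hB : (Finset.univ.filter fun i => ((G.support i).card - 1) - x i = 2).card = B) :
    ∃ k : ℕ, k ∣ G.cls σ ∧
      IsExteriorFace (τ.image p.onVertex) (Finset.univ.filter fun i => x i = 1).card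
        (Finset.univ.filter fun i => x i = 2).card k ((trace τ a σ).image p.onVertex) ∧
      IsExteriorFace (α.image q.onVertex) A B ((G.cls σ : ℝ) / k) (σ.image q.onVertex) := by
  have hGpos := fun i => (G.nonempty i).card_pos
  have hxle : ∀ i, x i ≤ 2 := fun i => by
    rw [hx]; have := G.inter_card_sub_one E i; have := hG.1 i; omega
  have hxG : ∀ i, x i ≤ (G.support i).card - 1 := fun i => by
    rw [hx]; exact G.inter_card_sub_one E i
  have hoff : ∀ i ∉ Set.range q.idx, (G.support i).card - 1 - x i = 0 := fun i hi => by
    rw [hx, hq.support_eq i hi, Finset.inter_univ, Nat.sub_self]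
  have hcount := card_sub_eq_one (y := fun i => (G.support i).card - 1)
    (fun i => by have := hG.1 i; omega) hxG
  have hcount' := card_sub_eq_two (y := fun i => (G.support i).card - 1)
    (fun i => by have := hG.1 i; omega) hxG
  rw [hA, hG.card_sub_one.1] at hcount
  rw [hB, hG.card_sub_one.2] at hcount'
  have hqG : (∀ k, ((q.onFace G).support k).card =
      ((G.support (q.idx k)).card - 1 - x (q.idx k)) + 1) → (q.onFace G).IsPi A B := by
    intro h
    have := isPi_onFace (q := q) (G := G) (n := fun i => (G.support i).card - 1 - x i)
      (fun i => by have := hG.1 i; omega) h hoff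
    rwa [hA, hB] at this
  have hqσ : ((σ.image q.onVertex : Finset _) : Set (Vertex d)) ⊆ (q.onFace G).verts := by
    rw [Finset.coe_image, ← q.image_verts]
    exact Set.image_mono hσG
  have hpρ : ∀ {H : Face c} {ρ : Finset (Vertex c)}, (ρ : Set (Vertex c)) ⊆ H.verts →
      ((ρ.image p.onVertex : Finset _) : Set (Vertex f)) ⊆ (p.onFace H).verts := by
    intro H ρ hρ
    rw [Finset.coe_image, ← p.image_verts]
    exact Set.image_mono hρ
  have hpPi : ∀ {H : Face c}, (∀ i, H.support i ⊆ E.support i) →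
      (∀ i, (H.support i).card = x i + 1) → (p.onFace H).IsPi
        (Finset.univ.filter fun i => x i = 1).card (Finset.univ.filter fun i => x i = 2).card := by
    intro H hHE hHx
    have hpH := hp.mono hHE
    refine isPi_onFace hxle (fun k => ?_) fun i hi => ?_
    · rw [← hHx]
      exact Finset.card_image_of_injOn (hpH.injOn k)
    · have := hHx i
      rw [hpH.card_eq i hi] at this
      omega
  by_cases hdisj : ∃ i, G.support i ∩ E.support i = ∅
  · obtain ⟨hle, hcls⟩ := hq.cls_of_disjoint hα hτα hτE hτ hσα hσG hσ hdisj
    have hx0 : ∀ i, x i = 0 := fun i => by rw [hx]; have := hle i; omega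
    have htr : trace τ a σ = {a} := by
      rw [trace, if_neg]
      rintro ⟨v, hv⟩
      obtain ⟨i, hi⟩ := hdisj
      have := Finset.mem_inter.2 ⟨hσG (Finset.mem_inter.1 hv).1 i, hτE (Finset.mem_inter.1 hv).2 i⟩
      rw [hi] at this
      exact Finset.notMem_empty _ this
    have hPi := hqG fun k => by
      rw [hq.card_image_support_of_inter_subsingleton k (hle _), hx0]
      have := hGpos (q.idx k); omega
    -- All `x i` vanish, since truncated subtraction also sends an empty intersection to dimension
    -- 0. The substitute vertex `a` is thus counted as a face of type `(0, 0)` and class 1.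
    refine ⟨1, one_dvd _, ?_, ?_⟩
    · let H : Face c := ⟨fun i => {a i}, fun i => Finset.singleton_nonempty _⟩
      have haE := hτE ha
      have hHE : ∀ i, H.support i ⊆ E.support i := fun i => by simpa [H] using haE i
      have haH : (({a} : Finset (Vertex c)) : Set (Vertex c)) = H.verts := by
        ext v
        simp only [H, Face.verts, Finset.coe_singleton, Set.mem_singleton_iff,
          Finset.mem_singleton]
        exact funext_iff
      have hPiH := hpPi hHE fun i => by rw [hx0]; rfl
      rw [htr, isExteriorFace_iff]
      refine ⟨Finset.image_subset_image (by simpa using ha), p.onFace H, hPiH,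
        hpρ haH.subset, ?_, ?_⟩
      · rw [hPiH.rk_eq]; simp [hx0]
      · rw [(hp.mono hHE).cls_image haH.subset, Face.cls, haH, H.lat_eq_gen,
          AddSubgroup.relIndex_self]
    · rw [isExteriorFace_iff]
      refine ⟨Finset.image_subset_image hσα, q.onFace G, hPi, hqσ, ?_, ?_⟩
      · refine le_antisymm (Finset.card_image_le.trans ?_)
          (rk_le_card_of_cls_ne_zero (hcls ▸ hσ))
        rw [hσcard, hG.rk_eq, hPi.rk_eq]
        simp only [hx0] at hcount hcount'
        simp at hcount hcount'
        omega
      · rw [hcls, Nat.cast_one, div_one]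
  · have hne : ∀ i, (G.support i ∩ E.support i).Nonempty := fun i => by
      by_contra h; exact hdisj ⟨i, Finset.not_nonempty_iff_eq_empty.1 h⟩
    let H : Face c := ⟨fun i => G.support i ∩ E.support i, hne⟩
    have hHE : ∀ i, H.support i ⊆ E.support i := fun i => Finset.inter_subset_right
    have hHx : ∀ i, (H.support i).card = x i + 1 := fun i => by
      rw [hx]; have := (hne i).card_pos
      change (G.support i ∩ E.support i).card = _
      omega
    obtain ⟨hρH, hρcard, hcls⟩ := hq.cls_of_inter (H := H) hα hτα hτE hτ hσα hσG hσ fun i => rfl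
    have hneρ : (σ ∩ τ).Nonempty := by
      rw [← Finset.card_pos, hρcard]; exact Nat.succ_pos _
    have htr : trace τ a σ = σ ∩ τ := if_pos hneρ
    have hPi := hqG fun k => by
      have h1 := hq.card_image_support_of_inter (G := G) k (hne _)
      have h2 := hHx (q.idx k)
      have h3 := hxG (q.idx k)
      have h4 := hGpos (q.idx k)
      change (G.support (q.idx k) ∩ E.support (q.idx k)).card = _ at h2
      omega
    have hPiH := hpPi hHE hHx
    have hH0 : H.cls (σ ∩ τ) ≠ 0 := fun h0 => hσ (by rw [hcls, h0, mul_zero])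
    have hinj : Set.InjOn p.onVertex ((σ ∩ τ : Finset _) : Set (Vertex c)) :=
      hp.onVertex_injOn.mono ((Finset.coe_subset.2 Finset.inter_subset_right).trans hτE)
    have hrkH : (p.onFace H).rk = H.rk := by
      have h1 : H.IsPi (Finset.univ.filter fun i => x i = 1).card
          (Finset.univ.filter fun i => x i = 2).card := by
        refine ⟨fun i => by rw [hHx]; have := hxle i; omega, ?_, ?_⟩ <;> simp [hHx]
      rw [h1.rk_eq, hPiH.rk_eq]
    refine ⟨H.cls (σ ∩ τ), Dvd.intro_left _ hcls.symm, ?_, ?_⟩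
    · rw [htr, isExteriorFace_iff]
      refine ⟨Finset.image_subset_image Finset.inter_subset_right, p.onFace H, hPiH, hpρ hρH,
        ?_, ?_⟩
      · rw [Finset.card_image_of_injOn hinj, hρcard, hrkH]
      · rw [(hp.mono hHE).cls_image hρH]
    · rw [isExteriorFace_iff]
      refine ⟨Finset.image_subset_image hσα, q.onFace G, hPi, hqσ, ?_, ?_⟩
      · refine le_antisymm ?_
          (rk_le_card_of_cls_ne_zero fun h0 => hσ (by rw [hcls, h0, zero_mul]))
        obtain ⟨u, hu⟩ := hq.exists_vertex
        -- The part `σ ∩ τ` contributes one point, so at most `|σ| - |σ ∩ τ| + 1` vertices remain,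
        -- which is the rank of the image of `G`.
        have himage : σ.image q.onVertex ⊆ insert u ((σ \ τ).image q.onVertex) := by
          intro z hz
          obtain ⟨v, hv, rfl⟩ := Finset.mem_image.1 hz
          by_cases hvτ : v ∈ τ
          · rw [(hu v).2 (hτE hvτ)]; exact Finset.mem_insert_self _ _
          · exact Finset.mem_insert_of_mem
              (Finset.mem_image_of_mem _ (Finset.mem_sdiff.2 ⟨hv, hvτ⟩))
        have h1 := Finset.card_le_card himage
        have h2 := Finset.card_insert_le u ((σ \ τ).image q.onVertex)
        have h3 := Finset.card_image_le (s := σ \ τ) (f := q.onVertex)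
        have h4 := Finset.card_sdiff_add_card_inter σ τ
        have h5 := hq.rk_add_rk (G := G) (H := H) fun i => rfl
        omega
      · rw [hcls, Nat.cast_mul, mul_div_assoc, div_self (by exact_mod_cast hH0), mul_one]

end Pairs

/-! ### Assembling the inequality -/

theorem starDims_le_two {s t : ℕ} (i : Fin s ⊕ Fin t) : starDims s t i ≤ 2 := by
  rcases i with i | i <;> simp [starDims]

theorem Face.card_support_sub_one_le {ι : Type} {c : ι → ℕ} (E : Face c) (i : ι) :
    (E.support i).card - 1 ≤ c i := by
  have : (E.support i).card ≤ c i + 1 := by simpa using Finset.card_le_univ (E.support i)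
  omega

theorem Face.rk_whole {ι : Type} [Fintype ι] (c : ι → ℕ) :
    (Face.whole c).rk = ∑ i, c i + 1 := by
  simp [Face.rk, Face.whole]

theorem card_le_sum_fiber {A B : Type*} [DecidableEq B] {S : Finset A} {T : Finset B} (f : A → B)
    {g : B → ℕ} (h : ∀ x ∈ S, f x ∈ T) (hg : ∀ b ∈ T, (S.filter fun a => f a = b).card ≤ g b) :
    S.card ≤ ∑ b ∈ T, g b := by
  rw [Finset.card_eq_sum_card_fiberwise h]
  exact Finset.sum_le_sum hg

theorem exteriorCount_le_sup {s t s' t' : ℕ} {c c' : ℤ} (hc : 1 ≤ c) (hc' : 1 ≤ c')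
    {α : Finset (Vertex (starDims s t))} (hα : HasClass (Face.whole _) α (c : ℝ)) :
    exteriorCount α s' t' (c' : ℝ) ≤
      (Finset.Icc (max 0 ((s : ℤ) - s')) (min ((s : ℤ) + t - s' - t') s)).sup fun e : ℤ =>
        ∑ w ∈ Finset.Icc 0 (min ((s' : ℤ) - s + e) t'),
          ∑ k ∈ Finset.Icc 1 c',
            ∑ j ∈ Finset.Icc 0 (t' : ℤ),
              ∑ i ∈ Finset.Icc w (min ((s' : ℤ) + t' - j) (s' + w)),
                F s' t' (c' : ℝ) i j (k : ℝ) *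
                  F ((s' : ℤ) - s + 2 * e) ((s : ℤ) + t - s' - t' - e) ((c : ℝ) / (c' : ℝ))
                    ((s' : ℤ) - i + 2 * w) ((t' : ℤ) - j - w) ((c' : ℝ) / (k : ℝ)) := by
  classical
  rw [exteriorCount]
  rcases Finset.eq_empty_or_nonempty
    (α.powerset.filter fun τ => IsExteriorFace α s' t' (c' : ℝ) τ) with h0 | ⟨τ, hτmem⟩
  · rw [h0, Finset.card_empty]; exact Nat.zero_le _
  have hcR : (c : ℝ) ≠ 0 := by exact_mod_cast (by omega : c ≠ 0)
  have hc'R : (c' : ℝ) ≠ 0 := by exact_mod_cast (by omega : c' ≠ 0)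
  obtain ⟨hτα, E, hE, hτE, hτcard, hτcls⟩ := isExteriorFace_iff.1 (Finset.mem_filter.1 hτmem).2
  have hτ0 : E.cls τ ≠ 0 := fun h0 => hc'R (by rw [← hτcls, h0, Nat.cast_zero])
  obtain ⟨hαcard, hαcls⟩ :=
    (hasClass_iff (E := Face.whole _) (τ := α) (fun v _ i => Finset.mem_univ _)).1 hα
  have hα0 : (Face.whole (starDims s t)).cls α ≠ 0 := fun h0 =>
    hcR (by rw [← hαcls, h0, Nat.cast_zero])
  have hαli := linearIndepOn_vec_of_hasClass hα hcR
  obtain ⟨p, hp, hpE⟩ := exists_isIsoOn hE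
  set S := (Finset.univ.filter fun i => starDims s t i - ((E.support i).card - 1) = 1).card with hS
  set T := (Finset.univ.filter fun i => starDims s t i - ((E.support i).card - 1) = 2).card with hT
  obtain ⟨q, hq⟩ := exists_isCollapse starDims_le_two E hS.symm hT.symm
  -- With this `e`, the face `E` is an edge in exactly `s' - s + e` triangle factors, whence `S = s'
  -- - s + 2e` and `T = s + t - s' - t' - e`.
  set e := (Finset.univ.filter fun i => starDims s t i = 1 ∧ (E.support i).card - 1 = 0).card with he
  have hcard1 := card_sub_eq_one starDims_le_two E.card_support_sub_one_le
  have hcard2 := card_sub_eq_two starDims_le_two E.card_support_sub_one_le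
  have hcard3 := card_one_add_card_one_zero starDims_le_two E.card_support_sub_one_le
  rw [hE.card_sub_one.1, (card_starDims s t).1] at hcard1 hcard3
  rw [hE.card_sub_one.2, (card_starDims s t).2] at hcard2
  have hes : e ≤ s := by
    rw [← (card_starDims s t).1]
    exact Finset.card_le_card fun i hi => by simp_all
  rw [← hS] at hcard1
  rw [← hT] at hcard2
  rw [← he] at hcard3
  obtain ⟨hmul, hqcard, hqinj, u, hu, hu'⟩ :=
    hq.contract_simplex hαli hαcard hα0 hτα hτE hτ0
  have hqα : HasClass (Face.whole _) (α.image q.onVertex) ((c : ℝ) / c') := by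
    refine (hasClass_iff fun v _ i => Finset.mem_univ _).2 ⟨hqcard, ?_⟩
    rw [← hαcls, ← hτcls, hmul, Nat.cast_mul, mul_div_assoc, div_self (by exact_mod_cast hτ0),
      mul_one]
  have hpτ : HasClass (Face.whole _) (τ.image p.onVertex) (c' : ℝ) := by
    refine (hasClass_iff fun v _ i => Finset.mem_univ _).2 ⟨?_, ?_⟩
    · rw [Finset.card_image_of_injOn (hp.onVertex_injOn.mono hτE), hτcard, hE.rk_eq]
      rw [Face.rk_whole, Fintype.sum_sum_type]
      simp [starDims, mul_comm]
    · rw [← hτcls, ← hpE, hp.cls_image hτE]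
  have hcc' : (1 : ℝ) ≤ c / c' := by
    have h1 : ((Face.whole (starDims S T)).cls (α.image q.onVertex) : ℝ) = c / c' :=
      ((hasClass_iff fun v _ i => Finset.mem_univ _).1 hqα).2
    rw [← h1]
    exact_mod_cast Nat.one_le_iff_ne_zero.2 fun h0 => hα0 (by rw [hmul, h0, zero_mul])
  obtain ⟨a, ha⟩ : τ.Nonempty := by
    rw [← Finset.card_pos, hτcard]; exact Nat.succ_pos _
  -- Quantifying over all `σ` lets `choose` return total functions; the values off the exterior
  -- faces are irrelevant.
  have key : ∀ σ : Finset (Vertex (starDims s t)), ∃ w k j i : ℤ,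
      σ ∈ (α.powerset.filter fun τ => IsExteriorFace α s' t' (c' : ℝ) τ) →
        w ∈ Finset.Icc 0 (min ((s' : ℤ) - s + e) t') ∧ k ∈ Finset.Icc 1 c' ∧
        j ∈ Finset.Icc 0 (t' : ℤ) ∧ i ∈ Finset.Icc w (min ((s' : ℤ) + t' - j) (s' + w)) ∧
        0 ≤ (s' : ℤ) - i + 2 * w ∧ 0 ≤ (t' : ℤ) - j - w ∧ (1 : ℝ) ≤ c' / k ∧
        IsExteriorFace (τ.image p.onVertex) i.toNat j.toNat k ((trace τ a σ).image p.onVertex) ∧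
        IsExteriorFace (α.image q.onVertex) ((s' : ℤ) - i + 2 * w).toNat
          ((t' : ℤ) - j - w).toNat ((c' : ℝ) / k) (σ.image q.onVertex) := by
    intro σ
    by_cases hσmem : σ ∈ (α.powerset.filter fun τ => IsExteriorFace α s' t' (c' : ℝ) τ)
    swap
    · exact ⟨0, 0, 0, 0, fun h => absurd h hσmem⟩
    obtain ⟨hσα, G, hG, hσG, hσcard, hσcls⟩ := isExteriorFace_iff.1 (Finset.mem_filter.1 hσmem).2
    have hσ0 : G.cls σ ≠ 0 := fun h0 => hc'R (by rw [← hσcls, h0, Nat.cast_zero])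
    obtain ⟨k, hk, h1, h2⟩ := exists_exterior_pair hq hp hαli hτα hτE hτ0 ha hσα hσG hσ0 hG hσcard
      (x := fun i => (G.support i ∩ E.support i).card - 1) (fun _ => rfl) rfl rfl
    have hG2 : ∀ i, (G.support i).card - 1 ≤ 2 := fun i => by have := hG.1 i; omega
    have hn1 := card_sub_eq_one hG2 (G.inter_card_sub_one E)
    have hn2 := card_sub_eq_two hG2 (G.inter_card_sub_one E)
    have hn3 := card_eq_one_le hG2 (G.inter_card_sub_one E)
    have hn4 := card_two_one_le (x := fun i => (G.support i ∩ E.support i).card - 1)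
      (y := fun i => (G.support i).card - 1)
    have hn5 := card_one_add_card_two_le hG2 (G.inter_card_sub_one E)
    rw [hG.card_sub_one.1] at hn1 hn3 hn5
    rw [hG.card_sub_one.2] at hn2 hn5
    -- A triangle of `G` fills its whole factor, so meeting `E` in an edge means that `E` is itself
    -- an edge there. This gives `w ≤ s' - s + e`.
    have hw : (Finset.univ.filter fun i => (G.support i).card - 1 = 2 ∧
        (G.support i ∩ E.support i).card - 1 = 1).card ≤
        (Finset.univ.filter fun i => starDims s t i = 2 ∧ (E.support i).card - 1 = 1).card := by
      refine Finset.card_le_card fun i hi => ?_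
      rw [Finset.mem_filter] at hi ⊢
      obtain ⟨-, hi1, hi2⟩ := hi
      have h3 := G.card_support_sub_one_le i
      have h4 := starDims_le_two (s := s) (t := t) i
      have h5 : starDims s t i = 2 := by omega
      have h6 : G.support i = Finset.univ := by
        rw [← Finset.card_eq_iff_eq_univ, Fintype.card_fin]; omega
      rw [h6, Finset.univ_inter] at hi2
      exact ⟨Finset.mem_univ _, h5, hi2⟩
    set w := (Finset.univ.filter fun i => (G.support i).card - 1 = 2 ∧
        (G.support i ∩ E.support i).card - 1 = 1).card
    set A := (Finset.univ.filter fun i =>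
        (G.support i).card - 1 - ((G.support i ∩ E.support i).card - 1) = 1).card
    set B := (Finset.univ.filter fun i =>
        (G.support i).card - 1 - ((G.support i ∩ E.support i).card - 1) = 2).card
    set i := (Finset.univ.filter fun i => (G.support i ∩ E.support i).card - 1 = 1).card
    set j := (Finset.univ.filter fun i => (G.support i ∩ E.support i).card - 1 = 2).card
    have hclsZ : (G.cls σ : ℤ) = c' := by exact_mod_cast hσcls
    have hk1 : 1 ≤ k := Nat.pos_of_dvd_of_pos hk (Nat.pos_of_ne_zero hσ0)
    have hkle : k ≤ G.cls σ := Nat.le_of_dvd (Nat.pos_of_ne_zero hσ0) hk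
    refine ⟨w, k, j, i, fun _ => ⟨?_, ?_, ?_, ?_, by omega, by omega, ?_, ?_, ?_⟩⟩
    · rw [Finset.mem_Icc]; omega
    · rw [Finset.mem_Icc]; omega
    · rw [Finset.mem_Icc]; omega
    · rw [Finset.mem_Icc]; omega
    · rw [Int.cast_natCast, one_le_div (by exact_mod_cast hk1), ← hclsZ]
      exact_mod_cast hkle
    · rw [Int.toNat_natCast, Int.toNat_natCast, Int.cast_natCast]; exact h1
    · rw [(by omega : ((s' : ℤ) - i + 2 * w).toNat = A), (by omega : ((t' : ℤ) - j - w).toNat = B),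
        Int.cast_natCast, ← hσcls]
      exact h2
  choose w k j i hkey using key
  refine le_trans ?_ (Finset.le_sup (b := (e : ℤ)) (by rw [Finset.mem_Icc]; omega))
  refine card_le_sum_fiber w (fun σ hσ => (hkey σ hσ).1) fun w₀ _ => ?_
  refine card_le_sum_fiber k
    (fun σ hσ => (hkey σ (Finset.mem_filter.1 hσ).1).2.1) fun k₀ _ => ?_
  refine card_le_sum_fiber j
    (fun σ hσ => (hkey σ (Finset.mem_filter.1 (Finset.mem_filter.1 hσ).1).1).2.2.1) fun j₀ _ => ?_
  refine card_le_sum_fiber i (fun σ hσ => ?_) fun i₀ _ => ?_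
  · simp only [Finset.mem_filter] at hσ
    obtain ⟨⟨⟨hσ, rfl⟩, rfl⟩, rfl⟩ := hσ
    exact (hkey σ (Finset.mem_filter.2 hσ)).2.2.2.1
  set S₄ := Finset.filter (fun σ => i σ = i₀) _
  have hS₄ : ∀ σ ∈ S₄, σ ∈ (α.powerset.filter fun τ => IsExteriorFace α s' t' (c' : ℝ) τ) ∧
      w σ = w₀ ∧ k σ = k₀ ∧ j σ = j₀ ∧ i σ = i₀ := by
    intro σ hσ
    have h1 := Finset.mem_filter.1 hσ
    have h2 := Finset.mem_filter.1 h1.1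
    have h3 := Finset.mem_filter.1 h2.1
    have h4 := Finset.mem_filter.1 h3.1
    exact ⟨h4.1, h4.2, h3.2, h2.2, h1.2⟩
  -- A member of the fibre supplies the sign conditions without which `F` is 0 by convention; an
  -- empty fibre needs no bound.
  rcases S₄.eq_empty_or_nonempty with h0 | ⟨σ₀, hσ₀⟩
  · rw [h0, Finset.card_empty]; exact Nat.zero_le _
  obtain ⟨hσ₀, hw₀, hk₀, hj₀, hi₀⟩ := hS₄ σ₀ hσ₀
  obtain ⟨b1, b2, b3, b4, b5, b6, b7, -, -⟩ := hkey σ₀ hσ₀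
  rw [hw₀] at b1 b4 b5 b6
  rw [hk₀] at b2 b7
  rw [hj₀] at b3 b4 b6
  rw [hi₀] at b4 b5
  rw [Finset.mem_Icc] at b1 b2 b3 b4
  refine le_trans ?_ (Nat.mul_le_mul
    (exteriorCount_le_F rfl rfl (by exact_mod_cast hc') hpτ (b1.1.trans b4.1) b3.1
      (by exact_mod_cast b2.1))
    (exteriorCount_le_F (a := S) (b := T) (by omega) (by omega) hcc' hqα b5 b6 b7))
  -- Within one fibre the types and classes are constant, so the pairs lie in a single product of
  -- two sets of exterior faces.
  rw [exteriorCount, exteriorCount, ← Finset.card_product]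
  refine Finset.card_le_card_of_injOn
    (fun σ => ((trace τ a σ).image p.onVertex, σ.image q.onVertex)) (fun σ hσ => ?_) ?_
  · obtain ⟨hσS, hwσ, hkσ, hjσ, hiσ⟩ := hS₄ σ hσ
    obtain ⟨-, -, -, -, -, -, -, h1, h2⟩ := hkey σ hσS
    rw [hkσ, hjσ, hiσ] at h1
    rw [hwσ, hkσ, hjσ, hiσ] at h2
    refine Finset.mem_coe.2 (Finset.mem_product.2 ⟨?_, ?_⟩)
    · rw [Finset.mem_filter, Finset.mem_powerset]
      exact ⟨h1.1, h1⟩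
    · rw [Finset.mem_filter, Finset.mem_powerset]
      exact ⟨h2.1, h2⟩
  · intro σ hσ ρ hρ hσρ
    obtain ⟨h1, h2⟩ := Prod.ext_iff.1 hσρ
    exact eq_of_trace_of_image hp hτE hqinj (fun v hv => hu v (hτE hv)) hu' ha
      (Finset.mem_powerset.1 (Finset.mem_filter.1 (hS₄ σ hσ).1).1)
      (Finset.mem_powerset.1 (Finset.mem_filter.1 (hS₄ ρ hρ).1).1) h1 h2

end Simplotope

theorem theorem6p3 (s t c s' t' c' : ℤ) :
    Simplotope.F s t (c : ℝ) s' t' (c' : ℝ) ≤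
      (Finset.Icc (max 0 (s - s')) (min (s + t - s' - t') s)).sup fun e : ℤ =>
        ∑ w ∈ Finset.Icc 0 (min (s' - s + e) t'),
          ∑ k ∈ Finset.Icc 1 c',
            ∑ j ∈ Finset.Icc 0 t',
              ∑ i ∈ Finset.Icc w (min (s' + t' - j) (s' + w)),
                Simplotope.F s' t' (c' : ℝ) i j (k : ℝ) *
                  Simplotope.F (s' - s + 2 * e) (s + t - s' - t' - e) ((c : ℝ) / (c' : ℝ))
                    (s' - i + 2 * w) (t' - j - w) ((c' : ℝ) / (k : ℝ)) := by
  classical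
  rw [Simplotope.F]
  split_ifs with h
  swap
  · exact Nat.zero_le _
  obtain ⟨hs, ht, hs', ht', hc, hc'⟩ := h
  lift s to ℕ using hs
  lift t to ℕ using ht
  lift s' to ℕ using hs'
  lift t' to ℕ using ht'
  refine Finset.sup_le fun α hα => ?_
  rw [Finset.mem_filter] at hα
  exact Simplotope.exteriorCount_le_sup (s := s) (t := t) (s' := s') (t' := t')
    (by exact_mod_cast hc) (by exact_mod_cast hc') hα.2.2
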